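/- \textbf{Conventions.} A \emph{pretree} is a set $P$ with a ternary betweenness relation ($y\in(x,z)$ means "$y$ is between $x$ and $z$") such that: $(x,x)=\emptyset$; $(x,y)=(y,x)$; if $y\in(x,z)$ then $z\notin(x,y)$; if $z\in(x,y)$ and $w\ne z$ then $z\in(x,w)$ or $z\in(y,w)$. Put $[x,y]=(x,y)\cup\{x,y\}$. A subset is \emph{convex} if it contains $[x,y]$ whenever it contains $x,y$, and \emph{linearly ordered} if of any three distinct points of it one is between the other two. An \emph{$\mathbb R$-tree} is a pretree in which every maximal linearly ordered subset is order isomorphic to an interval of $\mathbb R$. It carries a topology in which the branches $\{y\neq p : p\notin (x,y)\}$ ($x\ne p$) are open and the segments $[x,y]$ with $x\neq y$ are topological arcs (for instance the metric topology, if it is a metric $\mathbb R$-tree, or the topology generated by the branches). \emph{Arcs} are the segments $[a,b]$ with $a\neq b$, and \emph{subtrees} are the nonempty convex subsets. An action is \emph{minimal} if there is no proper invariant subtree. A homeomorphism $g$ of an $\mathbb R$-tree is \emph{nesting} if $g([a,b])\subsetneq[a,b]$ for some arc $[a,b]$. A group acts \emph{nestingly} if it contains a nesting element and \emph{non-nestingly}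 otherwise. An \emph{interval of translation} of a nesting homeomorphism $g$ is a nonempty convex linearly ordered subset $I$ with $g(I)=I$ on which $g$ acts by translation, i.e. $gx\in(x,g^2x)$ for all $x\in I$. An \emph{endpoint} of a convex set $A$ is a point of $\overline A\setminus A$. A group $G$ acts with \emph{non-overlapping translation intervals} if, for any two intervals of translation $I,J$ of nesting elements of $G$ with $I\cap J\neq\emptyset$, no endpoint of $I$ is contained in $J$. A \emph{cross-component} is a subtree $Q$ that is maximal with the property that for all $x,y\in Q$ there are intervals of translation $I_1,\dots,I_n$ ($n\ge 1$) of nesting elements of $G$ with $x\in I_1$, $y\in I_n$ and $I_i\cap I_{i+1}\neq\emptyset$ for $1\le i<n$. \textbf{Theorem.} Suppose that a finitely generated group $G$ acts by homeomorphisms, minimally and nestingly, on an $\mathbb R$-tree $T$ with non-overlapping translation intervals. Then $G$ acts by homeomorphisms and non-nestingly on an $\mathbb R$-tree $S$ with more than one point and without proper $G$-invariant subtree, such that every arc stabilizer of $S$ stabilizes an end of a cross-component of $T$: for every arc $[a,b]$ of $S$ there are a cross-component $Q$ of $T$ and an endpoint $e$ of $Q$ such that every $g\in G$ fixing $[a,b]$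 pointwise satisfies $gQ=Q$ and $ge=e$. -/

import Mathlib

universe u v

/-- A pretree: a set with a betweenness relation; `btw x y z` says that `y` is between `x` and `z`. -/
class Pretree (P : Type*) where
  btw : P → P → P → Prop
  not_btw_self : ∀ x y, ¬ btw x y x
  btw_symm : ∀ x y z, btw x z y ↔ btw y z x
  btw_asymm : ∀ x y z, btw x y z → ¬ btw x z y
  btw_or : ∀ x y z w, btw x z y → z ≠ w → btw x z w ∨ btw y z w

namespace Pretree

/-- The closed interval `[x, y]`; for `x ≠ y` these are the arcs of an `ℝ`-tree. -/
def seg {P : Type*} [Pretree P] (x y : P) : Set P := {z | z = x ∨ z = y ∨ btw x z y}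

/-- The branch at `p` that contains `x` (for `x ≠ p`): the points not separated from `x` by `p`. -/
def branch {P : Type*} [Pretree P] (p x : P) : Set P := {y | y ≠ p ∧ ¬ btw x p y}

/-- Convex subsets; the nonempty ones are the subtrees of an `ℝ`-tree. -/
def IsConvex {P : Type*} [Pretree P] (A : Set P) : Prop :=
  ∀ a ∈ A, ∀ b ∈ A, seg a b ⊆ A

/-- Linearly ordered subsets: of any three distinct points one is between the other two. -/
def IsLinear {P : Type*} [Pretree P] (I : Set P) : Prop :=
  ∀ x ∈ I, ∀ y ∈ I, ∀ z ∈ I, x ≠ y → y ≠ z → x ≠ z → btw x y z ∨ btw y z x ∨ btw z x y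

/-- `I` is order isomorphic to an interval of `ℝ`. The order on `I` that betweenness induces is
determined up to reversal, so the isomorphism is one of betweenness relations. -/
def IsRealInterval {P : Type*} [Pretree P] (I : Set P) : Prop :=
  ∃ f : P → ℝ, Set.InjOn f I ∧ (f '' I).OrdConnected ∧
    ∀ x ∈ I, ∀ y ∈ I, ∀ z ∈ I,
      (btw x y z ↔ (f x < f y ∧ f y < f z) ∨ (f z < f y ∧ f y < f x))

end Pretree

/-- An `ℝ`-tree: a pretree in which every maximal linearly ordered subset is order isomorphic
to an interval of `ℝ`. -/
def IsRTree (P : Type*) [Pretree P] : Prop :=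
  ∀ L : Set P, Maximal Pretree.IsLinear L → Pretree.IsRealInterval L

/-- The topology on an `ℝ`-tree is one for which the branches at every point are open and the
segments `[x, y]`, `x ≠ y`, are topological arcs. The metric topology of a metric `ℝ`-tree and the
topology generated by the branches are both of this kind, and homeomorphisms for such a topology
preserve betweenness. -/
structure IsTreeTopology (P : Type*) [Pretree P] [TopologicalSpace P] : Prop where
  isOpen_branch : ∀ p x : P, x ≠ p → IsOpen (Pretree.branch p x)
  seg_arc : ∀ x y : P, x ≠ y → Nonempty (Pretree.seg x y ≃ₜ unitInterval)

/-- `f` maps some arc properly into itself. -/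
def IsNestingMap {P : Type*} [Pretree P] (f : P → P) : Prop :=
  ∃ a b : P, a ≠ b ∧ f '' Pretree.seg a b ⊂ Pretree.seg a b

/-- The group `G` contains a nesting element. -/
def ActsNestingly (G P : Type*) [Group G] [Pretree P] [MulAction G P] : Prop :=
  ∃ g : G, IsNestingMap (fun x : P => g • x)

/-- There is no proper `G`-invariant subtree. -/
def ActsMinimally (G P : Type*) [Group G] [Pretree P] [MulAction G P] : Prop :=
  ∀ A : Set P, A.Nonempty → Pretree.IsConvex A → (∀ g : G, ∀ x ∈ A, g • x ∈ A) → A = Set.univ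

/-- `I` is an interval of translation of the nesting element `g`: a nonempty convex linearly
ordered invariant subset, all points of which `g` moves in the same direction along `I`. -/
def IsTranslationIntervalOf {G P : Type*} [Group G] [Pretree P] [MulAction G P]
    (g : G) (I : Set P) : Prop :=
  IsNestingMap (fun x : P => g • x) ∧ I.Nonempty ∧ Pretree.IsConvex I ∧ Pretree.IsLinear I ∧
    (fun x : P => g • x) '' I = I ∧ ∀ x ∈ I, Pretree.btw x (g • x) (g • g • x)

/-- `I` is an interval of translation of some nesting element of `G`. -/
def IsTranslationInterval (G : Type*) {P : Type*} [Group G] [Pretree P] [MulAction G P]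
    (I : Set P) : Prop :=
  ∃ g : G, IsTranslationIntervalOf g I

/-- `e` is an endpoint of the convex set `A`. -/
def IsEndpoint {P : Type*} [TopologicalSpace P] (A : Set P) (e : P) : Prop :=
  e ∈ closure A \ A

/-- If two intervals of translation meet, then neither contains an endpoint of the other. -/
def NonOverlapping (G P : Type*) [Group G] [Pretree P] [TopologicalSpace P] [MulAction G P] :
    Prop :=
  ∀ I J : Set P, IsTranslationInterval G I → IsTranslationInterval G J → (I ∩ J).Nonempty →
    ∀ e, IsEndpoint I e → e ∉ J

/-- `x` and `y` are joined by a finite sequence of intervals of translation, of which any two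
consecutive ones intersect. -/
def ChainJoined (G : Type*) {P : Type*} [Group G] [Pretree P] [MulAction G P] (x y : P) : Prop :=
  ∃ (n : ℕ) (I : Fin (n + 1) → Set P), (∀ i, IsTranslationInterval G (I i)) ∧
    x ∈ I 0 ∧ y ∈ I (Fin.last n) ∧ ∀ i : Fin n, (I i.castSucc ∩ I i.succ).Nonempty

/-- A cross-component: a subtree that is maximal with the property that any two of its points
are joined by such a sequence. -/
def IsCrossComponent (G : Type*) {P : Type*} [Group G] [Pretree P] [MulAction G P]
    (Q : Set P) : Prop :=
  Maximal (fun A : Set P => A.Nonempty ∧ Pretree.IsConvex A ∧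
    ∀ x ∈ A, ∀ y ∈ A, ChainJoined G x y) Q

/-! A cross-component `Q` and an endpoint `e` of `Q` determine a wall: the branch `B` at `e` that
contains `Q`. The walls form a `G`-invariant nested family, and `S` is its dual tree. Each wall is
blown up to an edge, and parts of `T` that no wall separates are collapsed. An arc of `S` meets the
interior of some edge; an element fixing the arc preserves that wall, and the wall determines `Q`
and `e` (`IsWall.unique`).

Walls exist because a nesting element has a bounded monotone orbit. This orbit spans an interval of
translation ending at a fixed point `p`, and non-overlap keeps the cross-component from passing `p`
(`NonOverlapping.exists_isWall`).

Walls may accumulate, so `S` need not be simplicial, and its points are `[0, 1]`-valued functions on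
half-spaces. Three facts make `S` an ℝ-tree. No other wall separates a point of `Q` from `e`
(`IsWall.eq_of_separates`), so each edge has two end vertices coming from `T`. Connectedness of
segments realises every coherent choice of sides between two points of `T` (`IsWall.complete`). A
linear set crosses only countably many walls (`IsWall.countable`), so summable weights metrise
maximal linear subsets of `S` (`Dual.isRTree`).

If `g` were nesting on `S`, then `k = g` or `k = g²` would push an interior point of an edge
monotonically along an arc. The boundary points `kⁿe` would then drift in `T` and span an interval
of translation crossing the wall `kB` at `ke`. Such an interval meets `kQ`, hence lies in `kQ`,
although `ke ∉ kQ` (`IsWall.no_drift`). Minimality is inherited from `T`. -/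

namespace Pretree

/-! ### Betweenness, segments and branches in a pretree -/

variable {P : Type*} [Pretree P] {a b c d p x y z w : P}

theorem btw_comm : btw x y z ↔ btw z y x := btw_symm x z y

theorem btw.symm (h : btw x y z) : btw z y x := btw_comm.1 h

theorem btw.ne_left (h : btw x y z) : y ≠ x := by
  rintro rfl
  exact btw_asymm _ _ _ h.symm h.symm

theorem btw.ne_right (h : btw x y z) : y ≠ z := h.symm.ne_left

theorem btw.ne (h : btw x y z) : x ≠ z := by
  rintro rfl
  exact not_btw_self _ _ h

theorem btw.not_btw (h : btw x y z) : ¬ btw x z y := btw_asymm _ _ _ h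

theorem btw.not_btw' (h : btw x y z) : ¬ btw y x z := fun h' => h.symm.not_btw h'.symm

theorem btw.or (h : btw x y z) (hw : y ≠ w) : btw x y w ∨ btw z y w := btw_or _ _ _ _ h hw

theorem btw.trans_right (h : btw a b c) (h' : btw a c d) : btw b c d := by
  rcases h'.or h.ne_right.symm with h1 | h1
  · exact absurd h1 h.not_btw
  · exact h1.symm

theorem btw.trans_left (h : btw a b c) (h' : btw a c d) : btw a b d := by
  have h2 := h.trans_right h'
  rcases h.or h2.ne with h1 | h1
  · exact h1
  · exact absurd h2.symm h1.symm.not_btw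

theorem btw.concat_left (h : btw a b c) (h' : btw b c d) : btw a b d := by
  rcases h.or h'.ne with h1 | h1
  · exact h1
  · exact absurd h1.symm h'.symm.not_btw

theorem btw.concat_right (h : btw a b c) (h' : btw b c d) : btw a c d :=
  (h'.symm.concat_left h.symm).symm

theorem left_mem_seg (x y : P) : x ∈ seg x y := Or.inl rfl

theorem right_mem_seg (x y : P) : y ∈ seg x y := Or.inr (Or.inl rfl)

theorem btw.mem_seg (h : btw x y z) : y ∈ seg x z := Or.inr (Or.inr h)

theorem seg_comm (x y : P) : seg x y = seg y x := by
  ext z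
  simp only [seg, Set.mem_ofPred_eq, btw_comm (x := x)]
  tauto

theorem mem_seg_self : z ∈ seg x x ↔ z = x := by
  simp [seg, not_btw_self]

theorem seg_subset_union (x y z : P) : seg x y ⊆ seg x z ∪ seg z y := by
  rintro w (rfl | rfl | h)
  · exact Or.inl (left_mem_seg _ _)
  · exact Or.inr (right_mem_seg _ _)
  · by_cases hw : w = z
    · exact Or.inl (hw ▸ right_mem_seg _ _)
    · rcases h.or hw with h | h
      · exact Or.inl h.mem_seg
      · exact Or.inr h.symm.mem_seg

theorem seg_subset_left (h : z ∈ seg x y) : seg x z ⊆ seg x y := by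
  rintro w hw
  rcases h with rfl | rfl | h
  · rw [mem_seg_self] at hw
    exact hw ▸ left_mem_seg _ _
  · exact hw
  · rcases hw with rfl | rfl | hw
    · exact left_mem_seg _ _
    · exact h.mem_seg
    · exact (hw.trans_left h).mem_seg

theorem seg_subset_right (h : z ∈ seg x y) : seg z y ⊆ seg x y := by
  rw [seg_comm x y, seg_comm z y]
  exact seg_subset_left (by rwa [seg_comm])

theorem isConvex_seg (x y : P) : IsConvex (seg x y) := by
  intro a ha b hb c hc
  rcases seg_subset_union x y a hb with h | h
  · rw [seg_comm] at hc
    exact seg_subset_left ha (seg_subset_right h hc)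
  · exact seg_subset_right ha (seg_subset_left h hc)

theorem self_mem_branch (hx : x ≠ p) : x ∈ branch p x := ⟨hx, not_btw_self _ _⟩

theorem branch_eq_of_mem (hx : x ≠ p) (h : y ∈ branch p x) : branch p y = branch p x := by
  ext z
  constructor
  · intro hz
    refine ⟨hz.1, fun hb => ?_⟩
    rcases hb.or h.1.symm with h1 | h1
    · exact h.2 h1
    · exact hz.2 h1.symm
  · intro hz
    refine ⟨hz.1, fun hb => ?_⟩
    rcases hb.or hx.symm with h1 | h1
    · exact h.2 h1.symm
    · exact hz.2 h1.symm

theorem notMem_branch_self : p ∉ branch p x := fun h => h.1 rfl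

theorem btw_of_mem_of_notMem_branch (hx : x ≠ p) (hy : y ∈ branch p x) (hz : z ∉ branch p x)
    (hzp : z ≠ p) : btw y p z := by
  rw [← branch_eq_of_mem hx hy] at hz
  by_contra h
  exact hz ⟨hzp, h⟩

theorem mem_seg_of_mem_of_notMem_branch (hx : x ≠ p) (hy : y ∈ branch p x)
    (hz : z ∉ branch p x) : p ∈ seg y z := by
  by_cases hzp : z = p
  · exact hzp ▸ right_mem_seg _ _
  · exact (btw_of_mem_of_notMem_branch hx hy hz hzp).mem_seg

theorem isConvex_branch (hx : x ≠ p) : IsConvex (branch p x) := by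
  intro a ha b hb c hc
  by_contra hcn
  rw [← branch_eq_of_mem hx ha] at hb hcn
  rcases hc with rfl | rfl | hc
  · exact hcn (self_mem_branch ha.1)
  · exact hcn hb
  · by_cases hcp : c = p
    · exact hb.2 (hcp ▸ hc)
    · have h1 : btw a p c := by
        by_contra h
        exact hcn ⟨hcp, h⟩
      exact hb.2 (h1.trans_left hc)

theorem isConvex_compl_branch (hx : x ≠ p) : IsConvex (branch p x)ᶜ := by
  intro a ha b hb c hc hcb
  rcases hc with rfl | rfl | hc
  · exact ha hcb
  · exact hb hcb
  · by_cases hap : a = p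
    · by_cases hbp : b = p
      · exact hc.ne (hap.trans hbp.symm)
      · have := btw_of_mem_of_notMem_branch hx hcb hb hbp
        subst hap
        exact hc.not_btw' this
    · have h1 := btw_of_mem_of_notMem_branch hx hcb ha hap
      by_cases hbp : b = p
      · subst hbp
        exact hc.symm.not_btw' h1
      · have h2 := btw_of_mem_of_notMem_branch hx hcb hb hbp
        have h3 := h1.symm.trans_right hc
        exact absurd h2 h3.not_btw'

/-- Branches at two points are nested. -/
theorem branch_nested {p q x y : P} (hx : x ≠ p) (hy : y ≠ q) :
    branch p x ⊆ branch q y ∨ branch q y ⊆ branch p x ∨ branch p x ⊆ (branch q y)ᶜ ∨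
      (branch p x)ᶜ ⊆ branch q y := by
  by_cases hpq : p = q
  · subst hpq
    by_cases h : y ∈ branch p x
    · exact Or.inl (branch_eq_of_mem hx h).symm.subset
    · refine Or.inr (Or.inr (Or.inl fun z hz hz' => h ?_))
      rw [← branch_eq_of_mem hx hz, branch_eq_of_mem hy hz']
      exact self_mem_branch hy
  by_cases hq : q ∈ branch p x
  · by_cases hp : p ∈ branch q y
    · refine Or.inr (Or.inr (Or.inr fun z hz => ?_))
      by_contra hz'
      have h1 := mem_seg_of_mem_of_notMem_branch hx hq hz
      have h2 := mem_seg_of_mem_of_notMem_branch hy hp hz'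
      rcases h1 with h1 | rfl | h1
      · exact hpq h1
      · exact hz' hp
      · rcases h2 with h2 | rfl | h2
        · exact hpq h2.symm
        · exact hz hq
        · exact h1.not_btw' h2
    · refine Or.inr (Or.inl fun z hz => ?_)
      by_contra hz'
      have h1 := mem_seg_of_mem_of_notMem_branch hy hz hp
      have h2 := mem_seg_of_mem_of_notMem_branch hx hq hz'
      rcases h1 with rfl | h1 | h1
      · exact notMem_branch_self hz
      · exact hpq h1.symm
      · rcases h2 with h2 | rfl | h2
        · exact hpq h2
        · exact hp hz
        · exact h1.symm.not_btw' h2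
  · by_cases hp : p ∈ branch q y
    · refine Or.inl fun z hz => ?_
      by_contra hz'
      have h1 := mem_seg_of_mem_of_notMem_branch hx hz hq
      have h2 := mem_seg_of_mem_of_notMem_branch hy hp hz'
      rcases h1 with rfl | h1 | h1
      · exact notMem_branch_self hz
      · exact hpq h1
      · rcases h2 with h2 | rfl | h2
        · exact hpq h2.symm
        · exact hq hz
        · exact h1.symm.not_btw' h2
    · refine Or.inr (Or.inr (Or.inl fun z hz hz' => ?_))
      have h1 := mem_seg_of_mem_of_notMem_branch hx hz hq
      have h2 := mem_seg_of_mem_of_notMem_branch hy hz' hp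
      rcases h1 with rfl | h1 | h1
      · exact notMem_branch_self hz
      · exact hpq h1
      · rcases h2 with rfl | h2 | h2
        · exact notMem_branch_self hz'
        · exact hpq h2.symm
        · exact h1.not_btw h2

/-! ### Linearly ordered sets -/

/-- A linear set does not contain three points in distinct branches at a point. -/
theorem IsLinear.not_tripod {L : Set P} (hL : IsLinear L) (hx : x ∈ L) (hy : y ∈ L) (hz : z ∈ L)
    (h1 : btw x p y) (h2 : btw y p z) (h3 : btw x p z) : False := by
  have key : ∀ {a b c : P}, btw a p b → btw b p c → btw a b c → False := by
    intro a b c h1 h2 h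
    rcases h.or h1.ne_right.symm with h4 | h4
    · exact h1.not_btw h4
    · exact h2.symm.not_btw h4
  rcases hL x hx y hy z hz h1.ne h2.ne h3.ne with h | h | h
  · exact key h1 h2 h
  · exact key h2 h3.symm h
  · exact key h3.symm h1 h

theorem isLinear_pair (x y : P) : IsLinear ({x, y} : Set P) := by
  rintro a (rfl | rfl) b (rfl | rfl) c (rfl | rfl) h1 h2 h3 <;> simp_all

/-- Adding a point between two points of a linear set keeps it linear. -/
theorem IsLinear.insert {L : Set P} (hL : IsLinear L) (hx : x ∈ L) (hy : y ∈ L)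
    (hz : btw x z y) : IsLinear (insert z L) := by
  have key : ∀ a ∈ L, ∀ b ∈ L, a ≠ b → z ≠ a → z ≠ b → btw a z b ∨ btw z a b ∨ btw z b a := by
    intro a ha b hb hab hza hzb
    by_contra! hcon
    obtain ⟨h1, h2, h3⟩ := hcon
    -- As `z` is not between `a` and `b`, these lie on one side of `z`; one of `x`, `y` lies on the
    -- other.
    have : ∃ w ∈ L, btw a z w ∧ btw b z w := by
      rcases hz.or hza with h | h
      · refine ⟨x, hx, h.symm, ?_⟩
        rcases h.or hzb with h' | h'
        · exact h'.symm
        · exact absurd h' h1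
      · refine ⟨y, hy, h.symm, ?_⟩
        rcases h.or hzb with h' | h'
        · exact h'.symm
        · exact absurd h' h1
    obtain ⟨w, hw, haw, hbw⟩ := this
    rcases hL a ha b hb w hw hab hbw.ne haw.ne with h | h | h
    · rcases h.or hzb.symm with h' | h'
      · exact h3 h'.symm
      · exact hbw.symm.not_btw h'
    · exact hbw.not_btw (haw.trans_right h.symm).symm
    · rcases h.or hza.symm with h' | h'
      · exact haw.symm.not_btw h'
      · exact h2 h'.symm
  have key' : ∀ a ∈ L, ∀ b ∈ L, a ≠ b → a ≠ z → b ≠ z →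
      btw a z b ∨ btw z a b ∨ btw z b a :=
    fun a ha b hb hab h1 h2 => key a ha b hb hab h1.symm h2.symm
  rintro u hu v hv w hw huv hvw huw
  rcases hu with rfl | hu
  · rcases hv with rfl | hv
    · exact absurd rfl huv
    · rcases hw with rfl | hw
      · exact absurd rfl huw
      · rcases key' v hv w hw hvw huv.symm huw.symm with h | h | h
        · exact Or.inr (Or.inr h.symm)
        · exact Or.inl h
        · exact Or.inr (Or.inl h.symm)
  · rcases hv with rfl | hv
    · rcases hw with rfl | hw
      · exact absurd rfl hvw
      · rcases key' u hu w hw huw huv hvw.symm with h | h | h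
        · exact Or.inl h
        · exact Or.inr (Or.inr h.symm)
        · exact Or.inr (Or.inl h)
    · rcases hw with rfl | hw
      · rcases key' u hu v hv huv huw hvw with h | h | h
        · exact Or.inr (Or.inl h.symm)
        · exact Or.inr (Or.inr h)
        · exact Or.inl h.symm
      · exact hL u hu v hv w hw huv hvw huw

theorem isLinear_seg (x y : P) : IsLinear (seg x y) := by
  -- `a ∈ seg x b` is the order of the segment read from `x`: `key` is totality, and `chain`
  -- converts two consecutive inequalities into betweenness.
  have key : ∀ a ∈ seg x y, ∀ b ∈ seg x y, a ∈ seg x b ∨ b ∈ seg x a := by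
    intro a ha b hb
    by_cases hab : a = b
    · exact Or.inl (hab ▸ right_mem_seg _ _)
    rcases ha with rfl | rfl | ha
    · exact Or.inl (left_mem_seg _ _)
    · exact Or.inr hb
    rcases hb with rfl | rfl | hb
    · exact Or.inr (left_mem_seg _ _)
    · exact Or.inl ha.mem_seg
    rcases ha.or hab with h | h
    · exact Or.inl h.mem_seg
    · exact Or.inr (h.trans_right hb.symm).symm.mem_seg
  have chain : ∀ a b c : P, a ≠ b → b ≠ c → a ∈ seg x b → b ∈ seg x c → btw a b c := by
    intro a b c hab hbc h1 h2
    rcases h1 with rfl | h1 | h1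
    · rcases h2 with h2 | h2 | h2
      · exact absurd h2.symm hab
      · exact absurd h2 hbc
      · exact h2
    · exact absurd h1 hab
    · rcases h2 with h2 | h2 | h2
      · exact absurd h2 h1.ne.symm
      · exact absurd h2 hbc
      · exact h1.trans_right h2
  intro a ha b hb c hc hab hbc hac
  rcases key a ha b hb with h1 | h1 <;> rcases key b hb c hc with h2 | h2 <;>
    rcases key a ha c hc with h3 | h3
  · exact Or.inl (chain a b c hab hbc h1 h2)
  · exact Or.inl (chain a b c hab hbc h1 h2)
  · exact Or.inr (Or.inl (chain a c b hac hbc.symm h3 h2).symm)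
  · exact Or.inr (Or.inr (chain c a b hac.symm hab h3 h1))
  · exact Or.inr (Or.inr (chain b a c hab.symm hac h1 h3).symm)
  · exact Or.inr (Or.inl (chain b c a hbc hac.symm h2 h3))
  · exact Or.inl (chain c b a hbc.symm hab.symm h2 h1).symm
  · exact Or.inl (chain c b a hbc.symm hab.symm h2 h1).symm

theorem _root_.Maximal.isConvex_of_isLinear {L : Set P} (hL : Maximal IsLinear L) :
    IsConvex L := by
  rintro a ha b hb c (rfl | rfl | hc)
  · exact ha
  · exact hb
  · exact hL.2 (hL.1.insert ha hb hc) (Set.subset_insert _ _) (Set.mem_insert _ _)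

theorem IsLinear.exists_maximal {I : Set P} (hI : IsLinear I) :
    ∃ L, I ⊆ L ∧ Maximal IsLinear L := by
  obtain ⟨L, h1, h2⟩ := zorn_subset_nonempty {A : Set P | IsLinear A} (by
    intro c hc hchain hne
    refine ⟨⋃₀ c, ?_, fun s hs => Set.subset_sUnion_of_mem hs⟩
    rintro x ⟨A, hA, hx⟩ y ⟨B, hB, hy⟩ z ⟨C, hC, hz⟩
    obtain ⟨D, hD, h1, h2⟩ := hchain.directedOn A hA B hB
    obtain ⟨E, hE, h3, h4⟩ := hchain.directedOn D hD C hC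
    exact hc hE x (h3 (h1 hx)) y (h3 (h2 hy)) z (h4 hz)) I hI
  exact ⟨L, h1, h2⟩

/-! ### Real coordinates on linear sets -/

variable {f : P → ℝ} {L : Set P}

/-- Concatenation moves the last two indices forward together; transitivity then moves the last one
alone. -/
theorem btw_of_lt_of_lt {c : ℕ → P} (h : ∀ n, btw (c n) (c (n + 1)) (c (n + 2))) {i j k : ℕ}
    (hij : i < j) (hjk : j < k) : btw (c i) (c j) (c k) := by
  have h1 : ∀ m, btw (c i) (c (i + 1 + m)) (c (i + 1 + m + 1)) := by
    intro m
    induction m with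
    | zero => exact h i
    | succ m ih => exact ih.concat_right (h (i + 1 + m))
  have h2 : ∀ m, btw (c i) (c j) (c (j + 1 + m)) := by
    intro m
    induction m with
    | zero =>
      obtain ⟨r, rfl⟩ := Nat.exists_eq_add_of_le (Nat.succ_le_of_lt hij)
      exact h1 r
    | succ m ih =>
      obtain ⟨r, hr⟩ := Nat.exists_eq_add_of_le (Nat.succ_le_of_lt hij)
      have h3 := h1 (r + 1 + m)
      have e1 : i + 1 + (r + 1 + m) = j + 1 + m := by omega
      rw [e1] at h3
      exact ih.trans_left h3
  obtain ⟨r, rfl⟩ := Nat.exists_eq_add_of_le (Nat.succ_le_of_lt hjk)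
  exact h2 r

/-- `f` is a coordinate on the convex set `L`, identifying it with an interval of `ℝ`. -/
structure IsCoord (f : P → ℝ) (L : Set P) : Prop where
  isConvex : IsConvex L
  injOn : Set.InjOn f L
  ordConnected : (f '' L).OrdConnected
  btw_iff : ∀ x ∈ L, ∀ y ∈ L, ∀ z ∈ L,
      (btw x y z ↔ (f x < f y ∧ f y < f z) ∨ (f z < f y ∧ f y < f x))

theorem _root_.IsRTree.exists_isCoord (hP : IsRTree P) {I : Set P} (hI : IsLinear I) :
    ∃ f L, I ⊆ L ∧ IsCoord f L := by
  obtain ⟨L, hIL, hL⟩ := hI.exists_maximal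
  obtain ⟨f, h1, h2, h3⟩ := hP L hL
  exact ⟨f, L, hIL, hL.isConvex_of_isLinear, h1, h2, h3⟩

theorem IsCoord.neg (h : IsCoord f L) : IsCoord (fun x => - f x) L where
  isConvex := h.isConvex
  injOn := fun x hx y hy hxy => h.injOn hx hy (neg_injective hxy)
  ordConnected := by
    have h1 : (fun x => - f x) '' L = -(f '' L) := by
      rw [← Set.image_neg_eq_neg, Set.image_image]
    rw [h1]
    have := h.ordConnected
    refine ⟨fun u hu v hv t ht => ?_⟩
    exact this.out hv hu ⟨neg_le_neg ht.2, neg_le_neg ht.1⟩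
  btw_iff := fun x hx y hy z hz => by
    rw [h.btw_iff x hx y hy z hz, neg_lt_neg_iff, neg_lt_neg_iff, neg_lt_neg_iff, neg_lt_neg_iff]
    tauto

theorem IsCoord.mem_seg_iff (h : IsCoord f L) (hx : x ∈ L) (hy : y ∈ L) (hz : z ∈ L) :
    y ∈ seg x z ↔ f y ∈ Set.uIcc (f x) (f z) := by
  have h1 : y = x ↔ f y = f x := (h.injOn.eq_iff hy hx).symm
  have h2 : y = z ↔ f y = f z := (h.injOn.eq_iff hy hz).symm
  change (y = x ∨ y = z ∨ btw x y z) ↔ _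
  rw [h1, h2, h.btw_iff x hx y hy z hz, Set.mem_uIcc]
  constructor
  · rintro (h | h | ⟨h, h'⟩ | ⟨h, h'⟩)
    · rw [h]
      simp [le_total]
    · rw [h]
      simp [le_total]
    · exact Or.inl ⟨h.le, h'.le⟩
    · exact Or.inr ⟨h.le, h'.le⟩
  · rintro (⟨h, h'⟩ | ⟨h, h'⟩)
    · rcases h.eq_or_lt with h | h
      · exact Or.inl h.symm
      · rcases h'.eq_or_lt with h' | h'
        · exact Or.inr (Or.inl h')
        · exact Or.inr (Or.inr (Or.inl ⟨h, h'⟩))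
    · rcases h.eq_or_lt with h | h
      · exact Or.inr (Or.inl h.symm)
      · rcases h'.eq_or_lt with h' | h'
        · exact Or.inl h'
        · exact Or.inr (Or.inr (Or.inr ⟨h, h'⟩))

theorem IsCoord.exists_eq (h : IsCoord f L) (hx : x ∈ L) (hy : y ∈ L) {t : ℝ}
    (ht : t ∈ Set.uIcc (f x) (f y)) : ∃ z ∈ L, f z = t ∧ z ∈ seg x y := by
  obtain ⟨z, hz, rfl⟩ := h.ordConnected.uIcc_subset ⟨x, hx, rfl⟩ ⟨y, hy, rfl⟩ ht
  exact ⟨z, hz, rfl, (h.mem_seg_iff hx hz hy).2 ht⟩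

theorem _root_.IsRTree.exists_btw (hP : IsRTree P) (hxy : x ≠ y) : ∃ m, btw x m y := by
  obtain ⟨f, L, hL, hf⟩ := hP.exists_isCoord (isLinear_pair x y)
  have hx : x ∈ L := hL (by simp)
  have hy : y ∈ L := hL (by simp)
  have hne : f x ≠ f y := fun h => hxy (hf.injOn hx hy h)
  obtain ⟨z, hz, hzt, -⟩ := hf.exists_eq hx hy (t := (f x + f y) / 2) (by
    rw [Set.mem_uIcc]
    rcases hne.lt_or_gt with h | h
    · left; constructor <;> linarith
    · right; constructor <;> linarith)
  refine ⟨z, (hf.btw_iff x hx z hz y hy).2 ?_⟩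
  rcases hne.lt_or_gt with h | h
  · left; constructor <;> linarith
  · right; constructor <;> linarith

/-! ### The branch topology -/

/-- The topology generated by the branches. -/
abbrev branchTopology (P : Type*) [Pretree P] : TopologicalSpace P :=
  TopologicalSpace.generateFrom {U | ∃ p x : P, x ≠ p ∧ U = branch p x}

/-- This supplies the topology of the dual tree. A coordinate parametrises `[x, y]` affinely. The
parametrisation is continuous because a point `p` either misses the segment, which then stays in one
branch at `p`, or cuts the parameter interval at a single value. A continuous injection of a compact
space into a Hausdorff space is an embedding. -/
theorem _root_.IsRTree.isTreeTopology_branchTopology (hP : IsRTree P) :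
    @IsTreeTopology P _ (branchTopology P) := by
  let _ : TopologicalSpace P := branchTopology P
  have hopen : ∀ p x : P, x ≠ p → IsOpen (branch p x) := fun p x hx =>
    TopologicalSpace.isOpen_generateFrom_of_mem ⟨p, x, hx, rfl⟩
  have : T2Space P := by
    refine ⟨fun x y hxy => ?_⟩
    obtain ⟨m, hm⟩ := hP.exists_btw hxy
    refine ⟨_, _, hopen m x hm.ne_left.symm, hopen m y hm.ne_right.symm,
      self_mem_branch hm.ne_left.symm, self_mem_branch hm.ne_right.symm, ?_⟩
    rw [Set.disjoint_left]
    intro z hz hz'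
    have h1 := branch_eq_of_mem hm.ne_left.symm hz
    have h2 := branch_eq_of_mem hm.ne_right.symm hz'
    have h3 : y ∈ branch m x := by
      rw [← h1, h2]
      exact self_mem_branch hm.ne_right.symm
    exact h3.2 hm
  refine ⟨hopen, fun x y hxy => ?_⟩
  obtain ⟨f, L, hL, hf⟩ := hP.exists_isCoord (isLinear_pair x y)
  have hx : x ∈ L := hL (by simp)
  have hy : y ∈ L := hL (by simp)
  have hne : f x ≠ f y := fun h => hxy (hf.injOn hx hy h)
  have hsub : seg x y ⊆ L := hf.isConvex x hx y hy
  have hex : ∀ t : unitInterval, ∃ z ∈ L, f z = f x + t * (f y - f x) ∧ z ∈ seg x y := by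
    intro t
    refine hf.exists_eq hx hy ?_
    rw [← segment_eq_uIcc]
    exact ⟨1 - t, t, by linarith [t.2.2], t.2.1, by ring, by simp only [smul_eq_mul]; ring⟩
  choose γ hγL hγ hγs using hex
  have hinj : Function.Injective γ := by
    intro s t h
    have h1 := hγ s
    rw [h, hγ t] at h1
    have h2 := mul_right_cancel₀ (sub_ne_zero.2 hne.symm) (add_left_cancel h1)
    exact (Subtype.ext h2).symm
  have hrange : Set.range γ = seg x y := by
    refine Set.Subset.antisymm (Set.range_subset_iff.2 hγs) fun z hz => ?_
    have hzL := hsub hz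
    have h1 := (hf.mem_seg_iff hx hzL hy).1 hz
    rw [← segment_eq_uIcc] at h1
    obtain ⟨u, v, hu, hv, huv, h2⟩ := h1
    refine ⟨⟨v, hv, by linarith⟩, hf.injOn (hγL _) hzL ?_⟩
    rw [hγ, ← h2]
    obtain rfl : u = 1 - v := by linarith
    simp only [smul_eq_mul]
    ring
  have hbtw : ∀ r s t : unitInterval, btw (γ r) (γ s) (γ t) → (r < s ∧ s < t) ∨ (t < s ∧ s < r) := by
    intro r s t h
    rw [hf.btw_iff _ (hγL r) _ (hγL s) _ (hγL t), hγ, hγ, hγ] at h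
    simp only [add_lt_add_iff_left] at h
    rcases hne.lt_or_gt with h1 | h1
    · have h2 : 0 < f y - f x := sub_pos.2 h1
      simpa only [mul_lt_mul_iff_left₀ h2, Subtype.coe_lt_coe] using h
    · have h2 : f y - f x < 0 := sub_neg.2 h1
      simp only [mul_lt_mul_right_of_neg h2, Subtype.coe_lt_coe] at h
      tauto
  have hcont : Continuous γ := by
    refine continuous_generateFrom_iff.2 ?_
    rintro _ ⟨p, q, hq, rfl⟩
    rw [isOpen_iff_mem_nhds]
    intro t ht
    have same : ∀ s, p ∉ seg (γ s) (γ t) → γ s ∈ branch p q := by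
      intro s hs
      rw [← branch_eq_of_mem hq ht]
      exact ⟨fun h => hs (h ▸ left_mem_seg _ _), fun h => hs h.symm.mem_seg⟩
    by_cases hp : p ∈ seg x y
    · rw [← hrange] at hp
      obtain ⟨r, rfl⟩ := hp
      have hrt : r ≠ t := fun h => ht.1 (h ▸ rfl)
      have hns : ∀ s, s ≠ r → ((r < s ∧ r < t) ∨ (s < r ∧ t < r)) → γ r ∉ seg (γ s) (γ t) := by
        rintro s hs hrs (h | h | h)
        · exact hs (hinj h).symm
        · exact hrt (hinj h)
        · rcases hbtw _ _ _ h with h | h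
          · rcases hrs with h' | h'
            · exact lt_asymm h.1 h'.1
            · exact lt_asymm h.2 h'.2
          · rcases hrs with h' | h'
            · exact lt_asymm h.1 h'.2
            · exact lt_asymm h.2 h'.1
      rcases hrt.lt_or_gt with h | h
      · filter_upwards [Ioi_mem_nhds h] with s hs
        exact same s (hns s (ne_of_gt hs) (Or.inl ⟨hs, h⟩))
      · filter_upwards [Iio_mem_nhds h] with s hs
        exact same s (hns s (ne_of_lt hs) (Or.inr ⟨hs, h⟩))
    · refine Filter.univ_mem' fun s => same s fun h => hp ?_
      exact isConvex_seg x y _ (hγs s) _ (hγs t) h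
  have hemb := (hcont.isClosedEmbedding hinj).isEmbedding
  rw [← hrange]
  exact ⟨hemb.toHomeomorph.symm⟩

/-! ### Betweenness-preserving actions and orbits of nesting elements -/

variable {G : Type*} [Group G] [MulAction G P]

theorem btw_smul_iff (hG : ∀ (g : G) (x y z : P), btw x y z → btw (g • x) (g • y) (g • z))
    (g : G) : btw (g • x) (g • y) (g • z) ↔ btw x y z := by
  refine ⟨fun h => ?_, hG g x y z⟩
  simpa using hG g⁻¹ _ _ _ h

theorem smul_mem_seg_iff (hG : ∀ (g : G) (x y z : P), btw x y z → btw (g • x) (g • y) (g • z))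
    (g : G) : g • y ∈ seg (g • x) (g • z) ↔ y ∈ seg x z := by
  change (_ ∨ _ ∨ _) ↔ (_ ∨ _ ∨ _)
  rw [btw_smul_iff hG, smul_left_cancel_iff, smul_left_cancel_iff]

theorem smul_mem_branch_iff
    (hG : ∀ (g : G) (x y z : P), btw x y z → btw (g • x) (g • y) (g • z)) (g : G) :
    g • y ∈ branch (g • p) (g • x) ↔ y ∈ branch p x := by
  change (_ ∧ _) ↔ (_ ∧ _)
  rw [btw_smul_iff hG, Ne, smul_left_cancel_iff]

theorem image_smul_seg (hG : ∀ (g : G) (x y z : P), btw x y z → btw (g • x) (g • y) (g • z))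
    (g : G) (x y : P) : (fun z => g • z) '' seg x y = seg (g • x) (g • y) := by
  ext z
  constructor
  · rintro ⟨w, hw, rfl⟩
    exact (smul_mem_seg_iff hG g).2 hw
  · intro hz
    refine ⟨g⁻¹ • z, ?_, by simp⟩
    rw [← smul_mem_seg_iff hG g]
    simpa using hz

/-- If `g` maps `[a, b]` properly into itself, then `g` or `g²` moves every lost point `c`
monotonically towards one end of `[a, b]`. -/
theorem _root_.IsRTree.exists_monotone_orbit (hP : IsRTree P)
    (hG : ∀ (g : G) (x y z : P), btw x y z → btw (g • x) (g • y) (g • z)) {g : G}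
    (hg : (fun z => g • z) '' seg a b ⊆ seg a b) (hc : c ∈ seg a b)
    (hcg : c ∉ (fun z => g • z) '' seg a b) :
    ∃ (k : G) (y : P), (y = a ∨ y = b) ∧ btw c (k • c) (k • k • c) ∧
      ∀ n : ℕ, k ^ (n + 1) • c ∈ seg (k ^ n • c) y := by
  have hmem : ∀ {z}, z ∈ seg a b → g • z ∈ seg a b := fun hz => hg ⟨_, hz, rfl⟩
  have hout : ∀ {z w}, z ∈ seg a b → w ∈ seg a b → c ∉ seg (g • z) (g • w) := by
    intro z w hz hw hcz
    rw [image_smul_seg hG] at hcg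
    exact hcg (isConvex_seg _ _ _ ((smul_mem_seg_iff hG g).2 hz) _
      ((smul_mem_seg_iff hG g).2 hw) hcz)
  have h1 := hmem hc
  have h2 := hmem h1
  have n1 : c ≠ g • c := fun h => hcg ⟨c, hc, h.symm⟩
  have n2 : c ≠ g • g • c := fun h => hcg ⟨g • c, h1, h.symm⟩
  have n3 : g • c ≠ g • g • c := fun h => n1 ((smul_left_cancel_iff g).1 h)
  obtain ⟨k, hk, hkb⟩ : ∃ k : G, (∀ z ∈ seg a b, k • z ∈ seg a b) ∧
      btw c (k • c) (k • k • c) := by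
    -- With `g • c` in the middle, `g` keeps the direction. With `g • g • c` in the middle, `g`
    -- reverses it and `g * g` is used. With `c` in the middle, `c` would lie in the image of `[a,
    -- b]`.
    rcases isLinear_seg a b _ hc _ h1 _ h2 n1 n3 n2 with h | h | h
    · exact ⟨g, fun z hz => hmem hz, h⟩
    · refine ⟨g * g, fun z hz => by rw [mul_smul]; exact hmem (hmem hz), ?_⟩
      simp only [mul_smul]
      have h4 : btw (g • c) (g • g • g • c) (g • g • c) := hG g _ _ _ h.symm
      have h5 : btw (g • g • c) (g • g • g • g • c) (g • g • g • c) := hG g _ _ _ h4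
      rcases h.symm.or h5.ne_left.symm with h6 | h6
      · exact h6
      · have h7 : btw (g • g • c) (g • g • g • g • c) (g • c) := h5.trans_left h4.symm
        exact absurd h7.symm h6.not_btw
    · exact absurd h.symm.mem_seg (by
        rw [seg_comm]
        exact hout h1 hc)
  obtain ⟨f, L, hL, hf⟩ := hP.exists_isCoord (isLinear_seg a b)
  have hcn : ∀ n : ℕ, k ^ n • c ∈ seg a b := by
    intro n
    induction n with
    | zero => simpa using hc
    | succ n ih => rw [pow_succ', mul_smul]; exact hk _ ih
  have hb : ∀ n : ℕ, btw (k ^ n • c) (k ^ (n + 1) • c) (k ^ (n + 2) • c) := by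
    intro n
    have := hG (k ^ n) _ _ _ hkb
    rwa [← mul_smul, ← mul_smul, ← mul_smul, ← pow_succ, ← pow_succ] at this
  refine ⟨k, ?_⟩
  -- Up to the sign of `f` the orbit increases, and `y` is the end of `[a, b]` with the larger
  -- coordinate.
  have key : ∀ f : P → ℝ, IsCoord f L → f c < f (k • c) → ∃ y, (y = a ∨ y = b) ∧
      btw c (k • c) (k • k • c) ∧ ∀ n : ℕ, k ^ (n + 1) • c ∈ seg (k ^ n • c) y := by
    intro f hf hlt
    have hmono : ∀ n : ℕ, f (k ^ n • c) < f (k ^ (n + 1) • c) := by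
      intro n
      induction n with
      | zero => simpa using hlt
      | succ n ih =>
        rcases (hf.btw_iff _ (hL (hcn _)) _ (hL (hcn _)) _ (hL (hcn _))).1 (hb n) with h | h
        · exact h.2
        · exact absurd h.2 ih.asymm
    have ha := hL (left_mem_seg a b)
    have hb := hL (right_mem_seg a b)
    obtain ⟨y, hy, hyL, hle⟩ : ∃ y, (y = a ∨ y = b) ∧ y ∈ L ∧ ∀ z ∈ seg a b, f z ≤ f y := by
      rcases le_total (f a) (f b) with h | h
      · refine ⟨b, Or.inr rfl, hb, fun z hz => ?_⟩
        have := (hf.mem_seg_iff ha (hL hz) hb).1 hz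
        rw [Set.uIcc_of_le h] at this
        exact this.2
      · refine ⟨a, Or.inl rfl, ha, fun z hz => ?_⟩
        have := (hf.mem_seg_iff ha (hL hz) hb).1 hz
        rw [Set.uIcc_of_ge h] at this
        exact this.2
    refine ⟨y, hy, hkb, fun n => ?_⟩
    rw [hf.mem_seg_iff (hL (hcn _)) (hL (hcn _)) hyL, Set.mem_uIcc]
    exact Or.inl ⟨(hmono n).le, hle _ (hcn _)⟩
  have hkc : k • c ∈ seg a b := hk c hc
  have hne : f c ≠ f (k • c) := fun h => hkb.ne_left (hf.injOn (hL hc) (hL hkc) h).symm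
  rcases hne.lt_or_gt with h | h
  · exact key f hf h
  · exact key _ hf.neg (neg_lt_neg h)

end Pretree

/-! ### Topology of segments and homeomorphisms -/

namespace IsTreeTopology

open Pretree

variable {T : Type*} [Pretree T] [TopologicalSpace T] {a b p q r x y z : T}

theorem t2Space (hT : IsTreeTopology T) (hP : IsRTree T) : T2Space T := by
  refine ⟨fun x y hxy => ?_⟩
  obtain ⟨m, hm⟩ := hP.exists_btw hxy
  refine ⟨_, _, hT.isOpen_branch m x hm.ne_left.symm, hT.isOpen_branch m y hm.ne_right.symm,
    self_mem_branch hm.ne_left.symm, self_mem_branch hm.ne_right.symm, ?_⟩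
  rw [Set.disjoint_left]
  intro z hz hz'
  have h1 := branch_eq_of_mem hm.ne_left.symm hz
  have h2 := branch_eq_of_mem hm.ne_right.symm hz'
  have h3 : y ∈ branch m x := by
    rw [← h1, h2]
    exact self_mem_branch hm.ne_right.symm
  exact h3.2 hm

theorem isClosed_seg (hT : IsTreeTopology T) (hP : IsRTree T) (x y : T) : IsClosed (seg x y) := by
  have := hT.t2Space hP
  by_cases hxy : x = y
  · have : seg x y = {x} := by
      ext z
      rw [← hxy, mem_seg_self, Set.mem_singleton_iff]
    rw [this]
    exact isClosed_singleton
  · obtain ⟨φ⟩ := hT.seg_arc x y hxy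
    have : CompactSpace (seg x y) := φ.symm.compactSpace
    exact (isCompact_iff_compactSpace.2 this).isClosed

theorem isPreconnected_seg (hT : IsTreeTopology T) (x y : T) : IsPreconnected (seg x y) := by
  by_cases hxy : x = y
  · have : seg x y = {x} := by
      ext z
      rw [← hxy, mem_seg_self, Set.mem_singleton_iff]
    rw [this]
    exact isPreconnected_singleton
  · obtain ⟨φ⟩ := hT.seg_arc x y hxy
    have : PreconnectedSpace (seg x y) :=
      φ.symm.surjective.denseRange.preconnectedSpace φ.symm.continuous
    exact isPreconnected_iff_preconnectedSpace.2 this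

/-- The unit interval stays dense after two parameters are removed, so the interior of an arc
accumulates at its ends. -/
theorem mem_closure_btw (hT : IsTreeTopology T) (h : a ≠ p) : p ∈ closure {z | btw a z p} := by
  obtain ⟨φ⟩ := hT.seg_arc a p h
  let a' : seg a p := ⟨a, left_mem_seg _ _⟩
  let p' : seg a p := ⟨p, right_mem_seg _ _⟩
  have h1 : Dense ((Set.univ : Set unitInterval) \ {φ a', φ p'}) :=
    dense_univ.sdiff_finite (Set.toFinite _)
  have h2 : Dense (φ.symm '' ((Set.univ : Set unitInterval) \ {φ a', φ p'})) :=
    φ.symm.surjective.denseRange.dense_image φ.symm.continuous h1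
  have h3 : p ∈ closure (Subtype.val '' (φ.symm '' ((Set.univ : Set unitInterval) \
      {φ a', φ p'}))) :=
    image_closure_subset_closure_image continuous_subtype_val ⟨p', h2 p', rfl⟩
  refine closure_mono ?_ h3
  rintro _ ⟨_, ⟨t, ⟨-, ht⟩, rfl⟩, rfl⟩
  rcases (φ.symm t).2 with h4 | h4 | h4
  · refine absurd ?_ ht
    left
    rw [← φ.apply_symm_apply t]
    exact congrArg φ (Subtype.ext h4)
  · refine absurd ?_ ht
    right
    rw [Set.mem_singleton_iff, ← φ.apply_symm_apply t]
    exact congrArg φ (Subtype.ext h4)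
  · exact h4

theorem mem_seg_of_forall_btw (hT : IsTreeTopology T) (hP : IsRTree T) (h : a ≠ p)
    (hz : ∀ z, btw a z p → z ∈ seg x y) : p ∈ seg x y :=
  (hT.isClosed_seg hP x y).closure_subset_iff.2 (fun z h => hz z h) (hT.mem_closure_btw h)

/-- Two points in the same branch at `p` are joined to `p` by segments that share a germ. -/
theorem exists_common_btw (hT : IsTreeTopology T) (hP : IsRTree T) (hq : q ≠ p)
    (hr : r ∈ branch p q) : ∃ m, btw p m q ∧ btw p m r := by
  by_contra! hcon
  refine hr.2 ?_
  -- With no common point, every point between `q` and `p` lies in `[q, r]`, and so does the limit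
  -- `p`.
  have h1 : p ∈ seg q r := by
    refine hT.mem_seg_of_forall_btw hP hq fun z hz => ?_
    by_cases hzr : z = r
    · exact hzr ▸ right_mem_seg _ _
    rcases hz.or hzr with h | h
    · exact h.mem_seg
    · exact absurd h (hcon z hz.symm)
  rcases h1 with h1 | h1 | h1
  · exact absurd h1.symm hq
  · exact absurd h1.symm hr.1
  · exact h1

/-- If `g • y` missed `[g • x, g • z]`, the preimage of this segment would be a connected set
joining `x` to `z` and avoiding `y`. The branches at `y` partition the complement of `y` into open
sets, and `x`, `z` lie in different ones. -/
theorem btw_smul {G : Type*} [Group G] [MulAction G T] [ContinuousConstSMul G T]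
    (hT : IsTreeTopology T) (g : G) (x y z : T) (h : btw x y z) :
    btw (g • x) (g • y) (g • z) := by
  by_contra hcon
  have hy : g • y ∉ seg (g • x) (g • z) := by
    rintro (h1 | h1 | h1)
    · exact h.ne_left (smul_left_cancel g h1)
    · exact h.ne_right (smul_left_cancel g h1)
    · exact hcon h1
  have hA : IsPreconnected ((fun w => g⁻¹ • w) '' seg (g • x) (g • z)) :=
    (hT.isPreconnected_seg _ _).image _ (continuous_const_smul g⁻¹).continuousOn
  have hyA : ∀ w ∈ (fun w => g⁻¹ • w) '' seg (g • x) (g • z), w ≠ y := by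
    rintro _ ⟨w, hw, rfl⟩ rfl
    simp only [smul_inv_smul] at hy
    exact hy hw
  have hx : x ≠ y := h.ne_left.symm
  have hopen : IsOpen (⋃ w ∈ {w | w ≠ y ∧ w ∉ branch y x}, branch y w) :=
    isOpen_biUnion fun w hw => hT.isOpen_branch y w hw.1
  have hcover : (fun w => g⁻¹ • w) '' seg (g • x) (g • z) ⊆
      branch y x ∪ ⋃ w ∈ {w | w ≠ y ∧ w ∉ branch y x}, branch y w := by
    intro w hw
    by_cases h1 : w ∈ branch y x
    · exact Or.inl h1
    · exact Or.inr (Set.mem_biUnion (x := w) ⟨hyA w hw, h1⟩ (self_mem_branch (hyA w hw)))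
  obtain ⟨w, -, hw1, hw2⟩ := hA _ _ (hT.isOpen_branch y x hx) hopen hcover
    ⟨x, ⟨g • x, left_mem_seg _ _, by simp⟩, self_mem_branch hx⟩
    ⟨z, ⟨g • z, right_mem_seg _ _, by simp⟩,
      Set.mem_biUnion (x := z) ⟨h.ne_right.symm, fun h' => h'.2 h⟩
        (self_mem_branch h.ne_right.symm)⟩
  simp only [Set.mem_iUnion] at hw2
  obtain ⟨v, ⟨hv, hv'⟩, hwv⟩ := hw2
  refine hv' ?_
  rw [← branch_eq_of_mem hx hw1, branch_eq_of_mem hv hwv]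
  exact self_mem_branch hv

/-! ### Intervals of translation spanned by orbits -/

variable {G : Type*} [Group G] [MulAction G T] {g : G}

/-- A monotone bounded orbit spans an interval of translation, one of whose ends is a fixed point
of `g`. -/
theorem exists_translationInterval (hT : IsTreeTopology T) (hP : IsRTree T)
    (hG : ∀ (g : G) (x y z : T), btw x y z → btw (g • x) (g • y) (g • z))
    (hg : btw x (g • x) (g • g • x)) (hy : ∀ n : ℕ, g ^ n • x ∈ seg x y) :
    ∃ (I : Set T) (p : T), IsTranslationIntervalOf g I ∧ (∀ n : ℕ, g ^ n • x ∈ I) ∧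
      x ≠ p ∧ p ∉ I ∧ ∀ z, btw x z p → z ∈ I := by
  have hb : ∀ n : ℕ, btw (g ^ n • x) (g ^ (n + 1) • x) (g ^ (n + 2) • x) := by
    intro n
    have := hG (g ^ n) _ _ _ hg
    rwa [← mul_smul, ← mul_smul, ← mul_smul, ← pow_succ, ← pow_succ] at this
  have hbt : ∀ i j k : ℤ, i < j → j < k → btw (g ^ i • x) (g ^ j • x) (g ^ k • x) := by
    intro i j k hij hjk
    obtain ⟨m, rfl⟩ := Int.le.dest hij.le
    obtain ⟨n, rfl⟩ := Int.le.dest hjk.le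
    have h1 : btw ((g ^ 0) • x) (g ^ m • x) (g ^ (m + n) • x) :=
      btw_of_lt_of_lt (c := fun n => g ^ n • x) hb (by omega) (by omega)
    have h2 := hG (g ^ i) _ _ _ h1
    simpa [← mul_smul, zpow_add, mul_assoc, pow_add] using h2
  -- `p` has as coordinate the supremum of the orbit, for the sign of the coordinate that makes the
  -- orbit increase.
  obtain ⟨p, hp1, hp2⟩ : ∃ p, (∀ n : ℕ, btw x (g ^ (n + 1) • x) p) ∧
      ∀ z, btw x z p → ∃ n : ℕ, btw x z (g ^ n • x) := by
    obtain ⟨f, L, hL, hf⟩ := hP.exists_isCoord (isLinear_seg x y)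
    have key : ∀ f : T → ℝ, IsCoord f L → f x < f (g • x) →
        ∃ p, (∀ n : ℕ, btw x (g ^ (n + 1) • x) p) ∧
          ∀ z, btw x z p → ∃ n : ℕ, btw x z (g ^ n • x) := by
      intro f hf hlt
      have hxL := hL (left_mem_seg x y)
      have hyL := hL (right_mem_seg x y)
      have hcL : ∀ n : ℕ, g ^ n • x ∈ L := fun n => hL (hy n)
      have hmono : StrictMono fun n : ℕ => f (g ^ n • x) := by
        refine strictMono_nat_of_lt_succ fun n => ?_
        induction n with
        | zero => simpa using hlt
        | succ n ih =>
          rcases (hf.btw_iff _ (hcL _) _ (hcL _) _ (hcL _)).1 (hb n) with h | h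
          · exact h.2
          · exact absurd h.2 ih.asymm
      have hle : ∀ n : ℕ, f (g ^ n • x) ≤ f y := by
        intro n
        have h1 := (hf.mem_seg_iff hxL (hcL n) hyL).1 (hy n)
        have h2 := (hf.mem_seg_iff hxL (hcL 1) hyL).1 (hy 1)
        have h3 : f x < f (g ^ 1 • x) := by simpa using hlt
        rw [Set.mem_uIcc] at h1 h2
        rcases h2 with h2 | h2
        · rcases h1 with h1 | h1
          · exact h1.2
          · linarith
        · linarith
      have hbdd : BddAbove (Set.range fun n : ℕ => f (g ^ n • x)) :=
        ⟨f y, Set.forall_mem_range.2 hle⟩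
      have hlt' : ∀ n : ℕ, f (g ^ n • x) < ⨆ n : ℕ, f (g ^ n • x) := fun n =>
        lt_of_lt_of_le (hmono n.lt_succ_self) (le_ciSup hbdd (n + 1))
      have hx0 : f x < ⨆ n : ℕ, f (g ^ n • x) := by simpa using hlt' 0
      obtain ⟨p, hpL, hp, -⟩ := hf.exists_eq hxL hyL (t := ⨆ n : ℕ, f (g ^ n • x)) (by
        rw [Set.mem_uIcc]
        exact Or.inl ⟨hx0.le, ciSup_le hle⟩)
      refine ⟨p, fun n => ?_, fun z hz => ?_⟩
      · rw [hf.btw_iff _ hxL _ (hcL _) _ hpL, hp]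
        refine Or.inl ⟨?_, hlt' _⟩
        simpa using hmono n.succ_pos
      · have hzL : z ∈ L := hf.isConvex _ hxL _ hpL hz.mem_seg
        rw [hf.btw_iff _ hxL _ hzL _ hpL, hp] at hz
        rcases hz with hz | hz
        · obtain ⟨n, hn⟩ := exists_lt_of_lt_ciSup hz.2
          exact ⟨n, (hf.btw_iff _ hxL _ hzL _ (hcL _)).2 (Or.inl ⟨hz.1, hn⟩)⟩
        · linarith
    have hne : f x ≠ f (g • x) := fun h => hg.ne_left
      (hf.injOn (hL (left_mem_seg x y)) (hL (by simpa using hy 1)) h).symm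
    rcases hne.lt_or_gt with h | h
    · exact key f hf h
    · exact key _ hf.neg (neg_lt_neg h)
  have hp0 : btw x (g • x) p := by simpa using hp1 0
  -- Points between `g • x` and `p` lie in `[g • x, g • p]`, hence so does their limit `p`. Were `p`
  -- strictly inside, the orbit would overtake `g⁻¹ • p`, hence also `p`.
  have hfix : g • p = p := by
    have hmem : p ∈ seg (g • x) (g • p) := by
      refine hT.mem_seg_of_forall_btw hP hp0.ne_right fun z hz => ?_
      have h1 : btw x (g • x) z := (hz.symm.trans_right hp0.symm).symm
      obtain ⟨n, hn⟩ := hp2 z (hz.symm.trans_left hp0.symm).symm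
      have h2 := h1.trans_right hn
      refine seg_subset_left ?_ h2.mem_seg
      cases n with
      | zero =>
        rw [pow_zero, one_smul] at hn
        exact absurd hn (not_btw_self _ _)
      | succ n =>
        rw [pow_succ', mul_smul, smul_mem_seg_iff hG]
        cases n with
        | zero => simpa using left_mem_seg x p
        | succ n => exact (hp1 n).mem_seg
    by_contra hne
    rcases hmem with h | h | h
    · exact hp0.ne_right h.symm
    · exact hne h.symm
    · have h1 := hG g⁻¹ _ _ _ h
      rw [inv_smul_smul, inv_smul_smul] at h1
      obtain ⟨n, hn⟩ := hp2 _ h1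
      have h2 := hG g _ _ _ hn
      rw [smul_inv_smul, ← mul_smul, ← pow_succ'] at h2
      cases n with
      | zero =>
        rw [pow_zero, one_smul] at hn
        exact absurd hn (not_btw_self _ _)
      | succ n =>
        have h3 : btw x (g • x) (g ^ (n + 1 + 1) • x) := by
          have := btw_of_lt_of_lt (c := fun n => g ^ n • x) hb (show 0 < 1 by omega)
            (show 1 < n + 1 + 1 by omega)
          simpa using this
        exact h2.not_btw (h3.trans_right (hp1 (n + 1)))
  have hmid : ∀ i j k : ℤ, i ≤ j → j ≤ k → g ^ j • x ∈ seg (g ^ i • x) (g ^ k • x) := by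
    intro i j k hij hjk
    rcases hij.eq_or_lt with rfl | hij
    · exact left_mem_seg _ _
    rcases hjk.eq_or_lt with rfl | hjk
    · exact right_mem_seg _ _
    exact (hbt i j k hij hjk).mem_seg
  -- Integer exponents make the union invariant under `g⁻¹` as well.
  let I : Set T := {z | ∃ i j : ℤ, z ∈ seg (g ^ i • x) (g ^ j • x)}
  have hsub : ∀ i j N : ℤ, |i| ≤ N → |j| ≤ N →
      seg (g ^ i • x) (g ^ j • x) ⊆ seg (g ^ (-N) • x) (g ^ N • x) := by
    intro i j N hi hj
    exact isConvex_seg _ _ _ (hmid _ _ _ (abs_le.1 hi).1 (abs_le.1 hi).2) _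
      (hmid _ _ _ (abs_le.1 hj).1 (abs_le.1 hj).2)
  have hI : ∀ z ∈ I, ∃ N : ℤ, ∀ M, N ≤ M → z ∈ seg (g ^ (-M) • x) (g ^ M • x) := by
    rintro z ⟨i, j, hz⟩
    exact ⟨max |i| |j|, fun M hM => hsub i j M ((le_max_left _ _).trans hM)
      ((le_max_right _ _).trans hM) hz⟩
  have hIseg : ∀ {N : ℤ} {z}, z ∈ seg (g ^ (-N) • x) (g ^ N • x) → z ∈ I := fun h => ⟨_, _, h⟩
  have hstep : ∀ z ∈ I, ∃ i : ℤ, z ∈ seg (g ^ i • x) (g ^ (i + 1) • x) := by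
    have h1 : ∀ (n : ℕ) (i : ℤ) (z : T), z ∈ seg (g ^ i • x) (g ^ (i + n) • x) →
        ∃ i : ℤ, z ∈ seg (g ^ i • x) (g ^ (i + 1) • x) := by
      intro n
      induction n with
      | zero =>
        intro i z hz
        rw [Nat.cast_zero, add_zero, mem_seg_self] at hz
        exact ⟨i, hz ▸ left_mem_seg _ _⟩
      | succ n ih =>
        intro i z hz
        rcases seg_subset_union _ _ (g ^ (i + n) • x) hz with h | h
        · exact ih i z h
        · refine ⟨i + n, ?_⟩
          rwa [Nat.cast_succ, ← add_assoc] at h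
    rintro z ⟨i, j, hz⟩
    rcases le_total i j with h | h
    · obtain ⟨n, rfl⟩ := Int.le.dest h
      exact h1 n i z hz
    · obtain ⟨n, rfl⟩ := Int.le.dest h
      exact h1 n j z (by rwa [seg_comm])
  -- `z` lies in one fundamental segment `[gⁱx, gⁱ⁺¹x]`, and its next two images lie in the next
  -- two.
  have htrans : ∀ z ∈ I, btw z (g • z) (g • g • z) := by
    intro z hz
    have hes : ∀ i : ℤ, g • g ^ i • x = g ^ (i + 1) • x := fun i => by
      rw [← mul_smul, add_comm, zpow_add, zpow_one]
    have he : ∀ i : ℤ, btw (g ^ i • x) (g • g ^ i • x) (g • g • g ^ i • x) := by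
      intro i
      rw [hes, hes]
      exact hbt _ _ _ (by omega) (by omega)
    obtain ⟨i, hz⟩ := hstep z hz
    rcases hz with rfl | rfl | hz
    · exact he i
    · exact he (i + 1)
    · rw [← hes] at hz
      have h1 := hz.trans_right (he i)
      have h2 := hG g _ _ _ hz
      have h3 := (h2.symm.trans_right h1.symm).symm
      have h4 := hG g _ _ _ h3
      exact (h3.concat_right h2).concat_left h4
  refine ⟨I, p, ⟨⟨x, p, hp0.ne, ?_⟩, ⟨x, 0, 0, by simp [left_mem_seg]⟩, ?_, ?_, ?_, htrans⟩,
    fun n => ⟨n, n, by simpa using left_mem_seg _ _⟩, hp0.ne, fun h => ?_, fun z hz => ?_⟩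
  -- `g` is nesting: it maps `[x, p]` onto `[g • x, p]`.
  · rw [image_smul_seg hG, hfix]
    refine (Set.ssubset_iff_of_subset (seg_subset_right hp0.mem_seg)).2
      ⟨x, left_mem_seg _ _, ?_⟩
    rintro (h | h | h)
    · exact hp0.ne_left h.symm
    · exact hp0.ne h
    · exact hp0.not_btw' h
  · intro a ha b hb
    obtain ⟨N, hN⟩ := hI a ha
    obtain ⟨M, hM⟩ := hI b hb
    intro c hc
    exact hIseg (isConvex_seg _ _ _ (hN (max N M) (le_max_left _ _)) _
      (hM (max N M) (le_max_right _ _)) hc)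
  · intro a ha b hb c hc
    obtain ⟨N, hN⟩ := hI a ha
    obtain ⟨M, hM⟩ := hI b hb
    obtain ⟨K, hK⟩ := hI c hc
    exact isLinear_seg _ _ a (hN (max N (max M K)) (by omega)) b (hM _ (by omega)) c
      (hK _ (by omega))
  · ext z
    constructor
    · rintro ⟨w, ⟨i, j, hw⟩, rfl⟩
      refine ⟨1 + i, 1 + j, ?_⟩
      rw [zpow_add, zpow_add, mul_smul, mul_smul, zpow_one]
      exact (smul_mem_seg_iff hG g).2 hw
    · rintro ⟨i, j, hz⟩
      refine ⟨g⁻¹ • z, ⟨-1 + i, -1 + j, ?_⟩, by simp⟩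
      rw [zpow_add, zpow_add, mul_smul, mul_smul, zpow_neg_one]
      exact (smul_mem_seg_iff hG g⁻¹).2 hz
  · have := htrans p h
    rw [hfix] at this
    exact this.ne_left rfl
  · obtain ⟨n, hn⟩ := hp2 z hz
    exact ⟨0, n, by simpa using hn.mem_seg⟩

end IsTreeTopology

open Pretree

open scoped Pointwise

/-! ### Cross-components -/

section CrossComponents

variable {G T : Type*} [Group G] [Pretree T] [MulAction G T] {x y z e : T} {Q I J : Set T}

/-- `x` and `y` lie in a common interval of translation. -/
def Linked (G : Type*) {T : Type*} [Group G] [Pretree T] [MulAction G T] (x y : T) : Prop :=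
  ∃ I : Set T, IsTranslationInterval G I ∧ x ∈ I ∧ y ∈ I

theorem Linked.symm (h : Linked G x y) : Linked G y x :=
  let ⟨I, hI, hx, hy⟩ := h
  ⟨I, hI, hy, hx⟩

/-- Chains can now be handled by induction. The closure is not reflexive: a point on no interval of
translation is joined to nothing, not even to itself. -/
theorem chainJoined_iff_transGen : ChainJoined G x y ↔ Relation.TransGen (Linked G) x y := by
  constructor
  · rintro ⟨n, I, hI, hx, hy, h⟩
    induction n generalizing x with
    | zero => exact .single ⟨I 0, hI 0, hx, hy⟩
    | succ n ih =>
      obtain ⟨z, hz, hz'⟩ := h 0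
      refine .head ⟨I 0, hI 0, hx, hz⟩ (ih (fun i => I i.succ) (fun i => hI _) hz' hy fun i => ?_)
      exact h i.succ
  · intro h
    induction h using Relation.TransGen.head_induction_on with
    | single h =>
      obtain ⟨J, hJ, hx, hy⟩ := h
      exact ⟨0, fun _ => J, fun _ => hJ, hx, hy, fun i => i.elim0⟩
    | head h _ ih =>
      obtain ⟨J, hJ, hx, hz⟩ := h
      obtain ⟨n, I, hI, hz', hy, h⟩ := ih
      refine ⟨n + 1, Fin.cons J I, Fin.cases hJ hI, hx, hy, Fin.cases ⟨_, hz, hz'⟩ h⟩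

theorem ChainJoined.symm (h : ChainJoined G x y) : ChainJoined G y x := by
  rw [chainJoined_iff_transGen] at h ⊢
  have : Std.Symm (Linked (T := T) G) := ⟨fun _ _ => Linked.symm⟩
  exact Std.Symm.symm _ _ h

theorem ChainJoined.trans (h : ChainJoined G x y) (h' : ChainJoined G y z) :
    ChainJoined G x z := by
  rw [chainJoined_iff_transGen] at h h' ⊢
  exact h.trans h'

theorem ChainJoined.of_mem (hI : IsTranslationInterval G I) (hx : x ∈ I) (hy : y ∈ I) :
    ChainJoined G x y :=
  chainJoined_iff_transGen.2 (.single ⟨I, hI, hx, hy⟩)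

theorem IsTranslationInterval.isConvex (hI : IsTranslationInterval G I) : IsConvex I :=
  hI.choose_spec.2.2.1

/-- The intervals of the chain, being convex, cover the segment between its two ends. -/
theorem ChainJoined.of_mem_seg (h : ChainJoined G x y) (hz : z ∈ seg x y) :
    ChainJoined G x z := by
  rw [chainJoined_iff_transGen] at h ⊢
  induction h with
  | single h =>
    obtain ⟨I, hI, hx, hy⟩ := h
    exact .single ⟨I, hI, hx, hI.isConvex _ hx _ hy hz⟩
  | @tail b c hb h ih =>
    rcases seg_subset_union _ _ b hz with h1 | h1
    · exact ih h1
    · obtain ⟨I, hI, hx, hy⟩ := h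
      exact hb.tail ⟨I, hI, hx, hI.isConvex _ hx _ hy h1⟩

/-- Classes of joined points are convex by `ChainJoined.of_mem_seg`, so they are exactly the maximal
sets in question. In particular distinct cross-components are disjoint. -/
theorem isCrossComponent_iff :
    IsCrossComponent G Q ↔ ∃ x, ChainJoined G x x ∧ Q = {y | ChainJoined G x y} := by
  have key : ∀ x, ChainJoined G x x → ({y | ChainJoined G x y} : Set T).Nonempty ∧
      IsConvex {y | ChainJoined G x y} ∧
      ∀ y ∈ {y | ChainJoined G x y}, ∀ z ∈ {y | ChainJoined G x y}, ChainJoined G y z := by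
    intro x hx
    refine ⟨⟨x, hx⟩, fun y hy z hz w hw => ?_, fun y hy z hz => hy.symm.trans hz⟩
    exact hy.trans ((hy.symm.trans hz).of_mem_seg hw)
  constructor
  · intro hQ
    obtain ⟨⟨x, hx⟩, hconv, hch⟩ := hQ.1
    have hxx := hch x hx x hx
    refine ⟨x, hxx, Set.Subset.antisymm (fun y hy => hch x hx y hy) ?_⟩
    exact hQ.2 (key x hxx) fun y hy => hch x hx y hy
  · rintro ⟨x, hx, rfl⟩
    exact ⟨key x hx, fun A hA hsub y hy => hA.2.2 x (hsub hx) y hy⟩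

theorem IsCrossComponent.eq_of_mem (hQ : IsCrossComponent G Q) (hx : x ∈ Q) :
    Q = {y | ChainJoined G x y} := by
  obtain ⟨w, hw, rfl⟩ := isCrossComponent_iff.1 hQ
  ext y
  exact ⟨fun h => hx.symm.trans h, fun h => hx.trans h⟩

theorem IsCrossComponent.eq_of_inter {Q' : Set T} (hQ : IsCrossComponent G Q)
    (hQ' : IsCrossComponent G Q') (hx : x ∈ Q) (hx' : x ∈ Q') : Q = Q' :=
  (hQ.eq_of_mem hx).trans (hQ'.eq_of_mem hx').symm

theorem IsCrossComponent.isConvex (hQ : IsCrossComponent G Q) : IsConvex Q := hQ.1.2.1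

theorem IsCrossComponent.subset_of_mem (hQ : IsCrossComponent G Q)
    (hI : IsTranslationInterval G I) (hx : x ∈ Q) (hxI : x ∈ I) : I ⊆ Q := by
  rw [hQ.eq_of_mem hx]
  exact fun y hy => ChainJoined.of_mem hI hxI hy

/-- The translate of an interval of `h` is an interval of the conjugate `g * h * g⁻¹`. -/
theorem IsTranslationInterval.image (hG : ∀ (g : G) (x y z : T), btw x y z →
    btw (g • x) (g • y) (g • z)) (hI : IsTranslationInterval G I) (g : G) :
    IsTranslationInterval G ((fun x => g • x) '' I) := by
  obtain ⟨h, ⟨a, b, hab, hn⟩, hne, hc, hl, hi, ht⟩ := hI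
  have hs : ∀ x : T, (g * h * g⁻¹) • g • x = g • h • x := fun x => by simp [mul_smul]
  refine ⟨g * h * g⁻¹, ⟨g • a, g • b, by simpa using hab, ?_⟩, hne.image _, ?_, ?_, ?_, ?_⟩
  · rw [image_smul_seg hG, hs, hs, ← image_smul_seg hG, ← image_smul_seg hG g a b]
    rw [image_smul_seg hG] at hn
    exact (MulAction.injective g).image_strictMono hn
  · rintro _ ⟨x, hx, rfl⟩ _ ⟨y, hy, rfl⟩
    dsimp only
    rw [← image_smul_seg hG]
    exact Set.image_mono (hc x hx y hy)
  · rintro _ ⟨x, hx, rfl⟩ _ ⟨y, hy, rfl⟩ _ ⟨z, hz, rfl⟩ h1 h2 h3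
    simp only [btw_smul_iff hG]
    exact hl x hx y hy z hz (fun h => h1 (h ▸ rfl)) (fun h => h2 (h ▸ rfl)) (fun h => h3 (h ▸ rfl))
  · rw [Set.image_image]
    simp only [hs]
    conv_rhs => rw [← hi]
    rw [Set.image_image]
  · rintro _ ⟨x, hx, rfl⟩
    dsimp only
    rw [hs, hs]
    exact hG _ _ _ _ (ht x hx)

theorem ChainJoined.smul (hG : ∀ (g : G) (x y z : T), btw x y z →
    btw (g • x) (g • y) (g • z)) (g : G) (h : ChainJoined G x y) :
    ChainJoined G (g • x) (g • y) := by
  rw [chainJoined_iff_transGen] at h ⊢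
  refine Relation.TransGen.lift (p := Linked G) (fun x => g • x) (fun a b hab => ?_) _ _ h
  obtain ⟨I, hI, ha, hb⟩ := hab
  exact ⟨_, hI.image hG g, ⟨a, ha, rfl⟩, ⟨b, hb, rfl⟩⟩

theorem IsCrossComponent.smul (hG : ∀ (g : G) (x y z : T), btw x y z →
    btw (g • x) (g • y) (g • z)) (g : G) (hQ : IsCrossComponent G Q) :
    IsCrossComponent G (g • Q) := by
  obtain ⟨x, hx, rfl⟩ := isCrossComponent_iff.1 hQ
  refine isCrossComponent_iff.2 ⟨g • x, hx.smul hG g, ?_⟩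
  ext y
  rw [Set.mem_smul_set_iff_inv_smul_mem]
  refine ⟨fun h => ?_, fun h => ?_⟩
  · simpa using ChainJoined.smul hG g h
  · simpa using ChainJoined.smul hG g⁻¹ h

end CrossComponents

/-! ### Walls: endpoints of cross-components -/

section Walls

variable {G T : Type*} [Group G] [Pretree T] [TopologicalSpace T] [MulAction G T]
  {x y z q r e e' : T} {Q Q' B B' : Set T}

/-- The branch at `y` around `e` is open and so meets `Q` in some `w`; then `y` lies between the
points `q` and `w` of `Q`. -/
theorem IsEndpoint.mem_of_btw (hT : IsTreeTopology T) (hQ : IsConvex Q) (he : IsEndpoint Q e)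
    (hq : q ∈ Q) (h : btw q y e) : y ∈ Q := by
  by_contra hy
  obtain ⟨w, hw, hwQ⟩ := mem_closure_iff.1 he.1 _ (hT.isOpen_branch y e h.ne_right.symm)
    (self_mem_branch h.ne_right.symm)
  have h1 : btw q y w := by
    rw [btw_comm]
    exact btw_of_mem_of_notMem_branch h.ne_right.symm hw (fun h' => h'.2 h.symm) h.ne_left.symm
  exact hy (hQ q hq w hwQ h1.mem_seg)

/-- `B` is the branch at the endpoint `e` of the cross-component `Q` that contains `Q`. -/
structure IsWall (G : Type*) {T : Type*} [Group G] [Pretree T] [TopologicalSpace T]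
    [MulAction G T] (Q : Set T) (e : T) (B : Set T) : Prop where
  isCrossComponent : IsCrossComponent G Q
  isEndpoint : IsEndpoint Q e
  exists_eq_branch : ∃ q ∈ Q, B = branch e q

namespace IsWall

theorem ne_of_mem (h : IsWall G Q e B) (hq : q ∈ Q) : q ≠ e :=
  fun h' => h.isEndpoint.2 (h' ▸ hq)

theorem eq_branch (h : IsWall G Q e B) (hq : q ∈ Q) : B = branch e q := by
  obtain ⟨r, hr, rfl⟩ := h.exists_eq_branch
  refine (branch_eq_of_mem (h.ne_of_mem hr) ⟨h.ne_of_mem hq, fun h' => ?_⟩).symm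
  exact h.isEndpoint.2 (h.isCrossComponent.isConvex r hr q hq h'.mem_seg)

theorem subset (h : IsWall G Q e B) : Q ⊆ B := fun q hq => by
  rw [h.eq_branch hq]
  exact self_mem_branch (h.ne_of_mem hq)

theorem notMem (h : IsWall G Q e B) : e ∉ B := by
  obtain ⟨r, hr, rfl⟩ := h.exists_eq_branch
  exact notMem_branch_self

theorem eq_branch' (h : IsWall G Q e B) (hr : r ∈ B) : B = branch e r := by
  obtain ⟨q, hq, rfl⟩ := h.exists_eq_branch
  exact (branch_eq_of_mem (h.ne_of_mem hq) hr).symm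

theorem ne_of_mem' (h : IsWall G Q e B) (hr : r ∈ B) : r ≠ e := fun h' => h.notMem (h' ▸ hr)

theorem nonempty (h : IsWall G Q e B) : Q.Nonempty := h.isCrossComponent.1.1

theorem mem_seg (h : IsWall G Q e B) (hx : x ∈ B) (hy : y ∉ B) : e ∈ seg x y := by
  have hB := h.eq_branch' hx
  rw [hB] at hx hy
  exact mem_seg_of_mem_of_notMem_branch hx.1 hx hy

theorem isConvex (h : IsWall G Q e B) : IsConvex B := by
  obtain ⟨q, hq⟩ := h.nonempty
  rw [h.eq_branch hq]
  exact isConvex_branch (h.ne_of_mem hq)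

theorem isConvex_compl (h : IsWall G Q e B) : IsConvex Bᶜ := by
  obtain ⟨q, hq⟩ := h.nonempty
  rw [h.eq_branch hq]
  exact isConvex_compl_branch (h.ne_of_mem hq)

theorem nested (h : IsWall G Q e B) (h' : IsWall G Q' e' B') :
    B ⊆ B' ∨ B' ⊆ B ∨ B ⊆ B'ᶜ ∨ Bᶜ ⊆ B' := by
  obtain ⟨q, hq⟩ := h.nonempty
  obtain ⟨q', hq'⟩ := h'.nonempty
  rw [h.eq_branch hq, h'.eq_branch hq']
  exact branch_nested (h.ne_of_mem hq) (h'.ne_of_mem hq')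

theorem mem_of_btw (h : IsWall G Q e B) (hT : IsTreeTopology T) (hq : q ∈ Q) (hy : btw q y e) : y ∈ Q :=
  h.isEndpoint.mem_of_btw hT h.isCrossComponent.isConvex hq hy

/-- All points of `B` are approached from `e` through the germ of `Q`. Whatever enters `B` through
`e` therefore meets `Q`, which drives the arguments below. -/
theorem exists_btw_mem (h : IsWall G Q e B) (hT : IsTreeTopology T) (hP : IsRTree T) (hr : r ∈ B) : ∃ m ∈ Q, btw e m r := by
  obtain ⟨q, hq⟩ := h.nonempty
  rw [h.eq_branch hq] at hr
  obtain ⟨m, h1, h2⟩ := hT.exists_common_btw hP (h.ne_of_mem hq) hr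
  exact ⟨m, h.mem_of_btw hT hq h1.symm, h2⟩

/-- A wall separating `q` from `e` has its boundary `e'` on `[q, e]`. If `e' = e`, the branches
agree. Otherwise `e' ∈ Q`, and the germ at `e'` meets both `Q` and `Q'`; then `Q = Q'` contains its
own endpoint. -/
theorem eq_of_separates (h : IsWall G Q e B) (hT : IsTreeTopology T) (hP : IsRTree T)
    (h' : IsWall G Q' e' B') (hq : q ∈ Q) (hsep : ¬ (q ∈ B' ↔ e ∈ B')) : B' = B := by
  by_cases hqB : q ∈ B'
  · have heB : e ∉ B' := fun h1 => hsep ⟨fun _ => h1, fun _ => hqB⟩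
    rcases h'.mem_seg hqB heB with h1 | h1 | h1
    · exact absurd h1.symm (h'.ne_of_mem' hqB)
    · rw [h'.eq_branch' hqB, h1, h.eq_branch hq]
    · have he' := h.mem_of_btw hT hq h1
      obtain ⟨m, hm, hm'⟩ := h'.exists_btw_mem hT hP hqB
      have hmQ := h.isCrossComponent.isConvex _ he' _ hq hm'.mem_seg
      have := h.isCrossComponent.eq_of_inter h'.isCrossComponent hmQ hm
      exact absurd (this ▸ he') h'.isEndpoint.2
  · have heB : e ∈ B' := by
      by_contra h1
      exact hsep ⟨fun h => absurd h hqB, fun h => absurd h h1⟩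
    have he' : e' ∈ Q := by
      rcases h'.mem_seg heB hqB with h1 | h1 | h1
      · exact absurd h1.symm (h'.ne_of_mem' heB)
      · exact h1 ▸ hq
      · exact h.mem_of_btw hT hq h1.symm
    obtain ⟨m, hm, hm'⟩ := h'.exists_btw_mem hT hP heB
    have hmQ := h.mem_of_btw hT he' hm'
    have := h.isCrossComponent.eq_of_inter h'.isCrossComponent hmQ hm
    exact absurd (this ▸ he') h'.isEndpoint.2

/-- If the branches were complementary, each would contain the boundary point of the other, and a
point between `e` and `e'` would lie in both. -/
theorem ne_compl (h : IsWall G Q e B) (hP : IsRTree T) (h' : IsWall G Q' e' B') : B' ≠ Bᶜ := by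
  intro hB
  have he : e ∈ B' := hB ▸ h.notMem
  have he' : e' ∈ B := by
    have := h'.notMem
    rw [hB] at this
    exact not_not.1 this
  obtain ⟨m, hm⟩ := hP.exists_btw (h'.ne_of_mem' he)
  have h1 : m ∈ B := by
    rw [h.eq_branch' he']
    exact ⟨hm.ne_left, hm.symm.not_btw⟩
  have h2 : m ∈ B' := by
    rw [h'.eq_branch' he]
    exact ⟨hm.ne_right, hm.not_btw⟩
  rw [hB] at h2
  exact h2 h1

/-- Each of `e`, `e'` lies on the segment from `q` to the other, so they agree; both
cross-components then contain points of one germ at `e`. -/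
theorem unique (h : IsWall G Q e B) (hT : IsTreeTopology T) (hP : IsRTree T) (h' : IsWall G Q' e' B) : e = e' ∧ Q = Q' := by
  obtain ⟨q, hq⟩ := h.nonempty
  have hqB := h.subset hq
  have hee : e = e' := by
    by_contra hne
    rcases h.mem_seg hqB h'.notMem with h1 | h1 | h1
    · exact h.ne_of_mem hq h1.symm
    · exact hne h1
    · rcases h'.mem_seg hqB h.notMem with h2 | h2 | h2
      · exact h'.ne_of_mem' hqB h2.symm
      · exact hne h2.symm
      · exact h1.not_btw h2
  subst hee
  obtain ⟨m, hm, hm'⟩ := h'.exists_btw_mem hT hP hqB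
  exact ⟨rfl, h.isCrossComponent.eq_of_inter h'.isCrossComponent (h.mem_of_btw hT hq hm'.symm) hm⟩

theorem smul [ContinuousConstSMul G T] (hG : ∀ (g : G) (x y z : T), btw x y z →
    btw (g • x) (g • y) (g • z)) (g : G) (h : IsWall G Q e B) :
    IsWall G (g • Q) (g • e) (g • B) := by
  obtain ⟨q, hq, hB⟩ := h.exists_eq_branch
  refine ⟨h.isCrossComponent.smul hG g, ⟨?_, ?_⟩, g • q, Set.smul_mem_smul_set hq, ?_⟩
  · have := h.isEndpoint.1
    rw [closure_smul]
    exact Set.smul_mem_smul_set this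
  · rw [Set.smul_mem_smul_set_iff]
    exact h.isEndpoint.2
  · rw [hB]
    ext z
    rw [Set.mem_smul_set_iff_inv_smul_mem, ← smul_mem_branch_iff hG g, smul_inv_smul]

end IsWall

end Walls

/-! ### Abstract wall systems -/

/-- The half-spaces cut out by a family of walls: its members and their complements. -/
def halfspaces {T : Type*} (𝓑 : Set (Set T)) : Set (Set T) := {h | h ∈ 𝓑 ∨ hᶜ ∈ 𝓑}

/-- An invariant nested family of half-spaces of `T`, each with a boundary point, that is locally
complete and countable along linear sets, and along which no element of `G` drifts. -/
structure WallSystem (G : Type*) {T : Type*} [Group G] [Pretree T] [MulAction G T]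
    (𝓑 : Set (Set T)) (bd : Set T → T) : Prop where
  nonempty : 𝓑.Nonempty
  nested : ∀ B ∈ 𝓑, ∀ B' ∈ 𝓑, B ⊆ B' ∨ B' ⊆ B ∨ B ⊆ B'ᶜ ∨ Bᶜ ⊆ B'
  compl_notMem : ∀ B ∈ 𝓑, Bᶜ ∉ 𝓑
  bd_notMem : ∀ B ∈ 𝓑, bd B ∉ B
  -- The points `q` and `bd B` become the two end vertices of the edge dual to `B`.
  exists_adjacent : ∀ B ∈ 𝓑, ∃ q ∈ B, ∀ B' ∈ 𝓑, B' ≠ B → (q ∈ B' ↔ bd B ∈ B')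
  isConvex : ∀ B ∈ 𝓑, IsConvex B
  isConvex_compl : ∀ B ∈ 𝓑, IsConvex Bᶜ
  bd_mem_seg : ∀ B ∈ 𝓑, ∀ x ∈ B, ∀ y ∉ B, bd B ∈ seg x y
  smul_mem : ∀ (g : G), ∀ B ∈ 𝓑, g • B ∈ 𝓑
  bd_smul : ∀ (g : G), ∀ B ∈ 𝓑, bd (g • B) = g • bd B
  -- `U` is a coherent choice of sides lying between `x` and `y`: it accepts every half-space that
  -- contains both.
  complete : ∀ (U : Set T → Prop) (x y : T), (∀ h ∈ halfspaces 𝓑, U hᶜ ↔ ¬ U h) →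
    (∀ h ∈ halfspaces 𝓑, ∀ k ∈ halfspaces 𝓑, h ⊆ k → U h → U k) →
    (∀ h ∈ halfspaces 𝓑, x ∈ h → y ∈ h → U h) → ∃ z, ∀ h ∈ halfspaces 𝓑, z ∈ h ↔ U h
  countable : ∀ R : Set T, IsLinear R → {B ∈ 𝓑 | ∃ x ∈ R, ∃ y ∈ R, x ∈ B ∧ y ∉ B}.Countable
  no_drift : ∀ (g : G) (y : T), ∀ B ∈ 𝓑, btw (bd B) (g • bd B) (g • g • bd B) →
    (∀ n : ℕ, g ^ n • bd B ∈ seg (bd B) y) → (bd B ∈ g • B ↔ g • g • bd B ∈ g • B)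

/-! ### The walls of `T` form a wall system -/

section

variable {G T : Type*} [Group G] [Pretree T] [TopologicalSpace T] [MulAction G T]

/-- The endpoint `p` of the interval `I` spanned by a nesting orbit is an endpoint of the
cross-component around `I`. A translation interval through `p` that continues into the branch of `c`
would share the germ of `I` at `p`, hence meet `I` and contain its endpoint. So no chain from `c`
leaves that branch. -/
theorem NonOverlapping.exists_isWall (hT : IsTreeTopology T) (hP : IsRTree T)
    (hG : ∀ (g : G) (x y z : T), btw x y z → btw (g • x) (g • y) (g • z))
    (hover : NonOverlapping G T) (hnest : ActsNestingly G T) :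
    ∃ (Q : Set T) (e : T) (B : Set T), IsWall G Q e B := by
  obtain ⟨g, a, b, -, hg⟩ := hnest
  obtain ⟨hsub, c, hc, hcg⟩ := (Set.ssubset_iff_exists).1 hg
  obtain ⟨k, y, -, hk, hky⟩ := hP.exists_monotone_orbit hG hsub hc hcg
  have hy : ∀ n : ℕ, k ^ n • c ∈ seg c y := by
    intro n
    induction n with
    | zero => simpa using left_mem_seg c y
    | succ n ih => exact seg_subset_right ih (hky n)
  obtain ⟨I, p, hI, hcI, hcp, hpI, hzI⟩ := hT.exists_translationInterval hP hG hk hy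
  have hI' : IsTranslationInterval G I := ⟨k, hI⟩
  have hc0 : c ∈ I := by simpa using hcI 0
  have hIe : IsEndpoint I p := ⟨closure_mono hzI (hT.mem_closure_btw hcp), hpI⟩
  have hcc : ChainJoined G c c := .of_mem hI' hc0 hc0
  have hQ : IsCrossComponent G {z | ChainJoined G c z} := isCrossComponent_iff.2 ⟨c, hcc, rfl⟩
  have hstep : ∀ z ∈ branch p c, ∀ w, Linked G z w → w ∈ branch p c := by
    rintro z hz w ⟨J, hJ, hzJ, hwJ⟩
    have hpJ : p ∉ J := by
      intro hpJ
      obtain ⟨m, h1, h2⟩ := hT.exists_common_btw hP hcp hz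
      exact hover I J hI' hJ ⟨m, hzI m h1.symm, hJ.isConvex _ hpJ _ hzJ h2.mem_seg⟩ p hIe hpJ
    rw [← branch_eq_of_mem hcp hz]
    exact ⟨fun h => hpJ (h ▸ hwJ), fun h => hpJ (hJ.isConvex _ hzJ _ hwJ h.mem_seg)⟩
  have hbranch : ∀ z, ChainJoined G c z → z ∈ branch p c := by
    intro z hz
    rw [chainJoined_iff_transGen] at hz
    induction hz with
    | single h => exact hstep _ (self_mem_branch hcp) _ h
    | tail _ h ih => exact hstep _ ih _ h
  refine ⟨_, p, _, hQ, ⟨?_, fun h => notMem_branch_self (hbranch p h)⟩, c, hcc, rfl⟩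
  exact closure_mono (fun z hz => ChainJoined.of_mem hI' hc0 hz) hIe.1

/-- The orbit of `e` spans an interval of translation `I` through `g • e`. If `I` entered `g • B`,
it would meet `g • Q` near `g • e` and lie in `g • Q`, which omits its endpoint `g • e`. -/
theorem IsWall.no_drift [ContinuousConstSMul G T] (hT : IsTreeTopology T) (hP : IsRTree T)
    {Q B : Set T} {e y : T} (h : IsWall G Q e B) {g : G} (hg : btw e (g • e) (g • g • e))
    (hy : ∀ n : ℕ, g ^ n • e ∈ seg e y) : e ∈ g • B ↔ g • g • e ∈ g • B := by
  have hG : ∀ (g : G) (x y z : T), btw x y z → btw (g • x) (g • y) (g • z) := hT.btw_smul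
  obtain ⟨I, p, hI, heI, -⟩ := hT.exists_translationInterval hP hG hg hy
  have hW := h.smul hG g
  have h0 : e ∈ I := by simpa using heI 0
  have h1 : g • e ∈ I := by simpa using heI 1
  have h2 : g • g • e ∈ I := by simpa [pow_two, mul_smul] using heI 2
  have key : ∀ r ∈ I, r ∉ g • B := by
    intro r hr hrB
    obtain ⟨m, hm, hm'⟩ := hW.exists_btw_mem hT hP hrB
    exact hW.isEndpoint.2 (hW.isCrossComponent.subset_of_mem ⟨g, hI⟩ hm
      (hI.2.2.1 _ h1 _ hr hm'.mem_seg) h1)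
  exact iff_of_false (key _ h0) (key _ h2)

/-- A crossed wall has a cross-component that fills an open interval of the line next to `e`, hence
contains a point with rational coordinate. This rational and the side on which `e` lies recover the
wall. -/
theorem IsWall.countable (hT : IsTreeTopology T) (hP : IsRTree T) {R : Set T} (hR : IsLinear R) :
    {B : Set T | (∃ Q e, IsWall G Q e B) ∧ ∃ x ∈ R, ∃ y ∈ R, x ∈ B ∧ y ∉ B}.Countable := by
  obtain ⟨f, L, hRL, hf⟩ := hP.exists_isCoord hR
  let Z : ℚ × Bool → Set (Set T) := fun r => {B | ∃ Q e, IsWall G Q e B ∧ e ∈ L ∧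
    ∃ z ∈ L, z ∈ Q ∧ f z = r.1 ∧ (f e < f z ↔ r.2 = true)}
  have hZ : ∀ r, (Z r).Subsingleton := by
    rintro r B ⟨Q, e, hB, he, z, hzL, hzQ, hz, hs⟩ B' ⟨Q', e', hB', he', z', hzL', hzQ', hz', hs'⟩
    obtain rfl : z = z' := hf.injOn hzL hzL' (hz.trans hz'.symm)
    obtain rfl := hB.isCrossComponent.eq_of_inter hB'.isCrossComponent hzQ hzQ'
    -- On a given side only the first exit from `Q` is possible, since all points before an endpoint
    -- belong to `Q`.
    have key : ∀ {e e' : T}, e ∈ L → e' ∈ L → IsEndpoint Q e → IsEndpoint Q e' →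
        e ∈ seg z e' → e = e' := by
      intro e e' he he' hE hE' h
      rcases h with h | h | h
      · exact absurd (h ▸ hzQ) hE.2
      · exact h
      · exact absurd (hE'.mem_of_btw hT hB.isCrossComponent.isConvex hzQ h) hE.2
    have hez : f e ≠ f z := fun h => hB.ne_of_mem hzQ (hf.injOn he hzL h).symm
    have hez' : f e' ≠ f z := fun h => hB'.ne_of_mem hzQ (hf.injOn he' hzL h).symm
    have hor : e ∈ seg z e' ∨ e' ∈ seg z e := by
      rw [hf.mem_seg_iff hzL he he', hf.mem_seg_iff hzL he' he, Set.mem_uIcc, Set.mem_uIcc]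
      have hss : f e < f z ↔ f e' < f z := hs.trans hs'.symm
      rcases hez.lt_or_gt with h | h
      · have h' := hss.1 h
        rcases le_total (f e) (f e') with h1 | h1
        · exact Or.inr (Or.inr ⟨h1, h'.le⟩)
        · exact Or.inl (Or.inr ⟨h1, h.le⟩)
      · have h' : f z < f e' := by
          rcases hez'.lt_or_gt with h1 | h1
          · exact absurd (hss.2 h1) h.asymm
          · exact h1
        rcases le_total (f e) (f e') with h1 | h1
        · exact Or.inl (Or.inl ⟨h.le, h1⟩)
        · exact Or.inr (Or.inl ⟨h'.le, h1⟩)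
    obtain rfl : e = e' := by
      rcases hor with h | h
      · exact key he he' hB.isEndpoint hB'.isEndpoint h
      · exact (key he' he hB'.isEndpoint hB.isEndpoint h).symm
    rw [hB.eq_branch hzQ, hB'.eq_branch hzQ]
  refine (Set.countable_iUnion fun r => (hZ r).countable).mono ?_
  rintro B ⟨⟨Q, e, hB⟩, x, hx, y, hy, hxB, hyB⟩
  have heL : e ∈ L := hf.isConvex _ (hRL hx) _ (hRL hy) (hB.mem_seg hxB hyB)
  obtain ⟨m, hmQ, hm⟩ := hB.exists_btw_mem hT hP hxB
  have hmL : m ∈ L := hf.isConvex _ heL _ (hRL hx) hm.mem_seg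
  have hne : f e ≠ f m := fun h => hm.ne_left (hf.injOn heL hmL h).symm
  obtain ⟨q, hq⟩ : ∃ q : ℚ, (f e < q ∧ q < f m) ∨ (f m < q ∧ q < f e) := by
    rcases hne.lt_or_gt with h | h
    · obtain ⟨q, hq⟩ := exists_rat_btwn h
      exact ⟨q, Or.inl hq⟩
    · obtain ⟨q, hq⟩ := exists_rat_btwn h
      exact ⟨q, Or.inr hq⟩
  obtain ⟨z, hzL, hz, -⟩ := hf.exists_eq heL hmL (t := q) (by
    rw [Set.mem_uIcc]
    exact hq.imp (fun h => ⟨h.1.le, h.2.le⟩) (fun h => ⟨h.1.le, h.2.le⟩))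
  have hzb : btw m z e := by
    rw [hf.btw_iff _ hmL _ hzL _ heL, hz]
    exact hq.symm
  refine Set.mem_iUnion.2 ⟨(q, decide (f e < f z)), Q, e, hB, heL, z, hzL,
    hB.mem_of_btw hT hmQ hzb, hz, by simp⟩

/-- If no point realises `U`, every point lies in a rejected half-space. The points of `[x, y]` that
share one with `x`, and those that share one with `y`, form a partition into two nonempty relatively
open sets, contradicting connectedness. -/
theorem IsWall.complete (hT : IsTreeTopology T) (hP : IsRTree T) {𝓑 : Set (Set T)}
    (h𝓑 : 𝓑 = {B : Set T | ∃ Q e, IsWall G Q e B})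
    (U : Set T → Prop) (x y : T) (hU : ∀ h ∈ halfspaces 𝓑, U hᶜ ↔ ¬ U h)
    (hmono : ∀ h ∈ halfspaces 𝓑, ∀ k ∈ halfspaces 𝓑, h ⊆ k → U h → U k)
    (hxy : ∀ h ∈ halfspaces 𝓑, x ∈ h → y ∈ h → U h) :
    ∃ z, ∀ h ∈ halfspaces 𝓑, z ∈ h ↔ U h := by
  by_contra! hcon
  have hmem : ∀ {B}, B ∈ 𝓑 ↔ ∃ Q e, IsWall G Q e B := by
    intro B
    rw [h𝓑]
    rfl
  have hcompl : ∀ {h}, h ∈ halfspaces 𝓑 → hᶜ ∈ halfspaces 𝓑 := by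
    rintro h (h1 | h1)
    · exact Or.inr (by rwa [compl_compl])
    · exact Or.inl h1
  have hconv : ∀ h ∈ halfspaces 𝓑, IsConvex h := by
    rintro h (h1 | h1)
    · obtain ⟨Q, e, hB⟩ := hmem.1 h1
      exact hB.isConvex
    · obtain ⟨Q, e, hB⟩ := hmem.1 h1
      simpa using hB.isConvex_compl
  have hex : ∀ z, ∃ h ∈ halfspaces 𝓑, z ∈ h ∧ ¬ U h := by
    intro z
    obtain ⟨h, hh, ⟨h1, h2⟩ | ⟨h1, h2⟩⟩ := hcon z
    · exact ⟨h, hh, h1, h2⟩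
    · exact ⟨hᶜ, hcompl hh, h1, fun h3 => (hU h hh).1 h3 h2⟩
  let C : T → T → Prop := fun x z => ∃ h ∈ halfspaces 𝓑, x ∈ h ∧ z ∈ h ∧ ¬ U h
  have cover : ∀ x y z, z ∈ seg x y → C x z ∨ C y z := by
    intro x y z hz
    obtain ⟨h, hh, hzh, hUh⟩ := hex z
    by_cases hx : x ∈ h
    · exact Or.inl ⟨h, hh, hx, hzh, hUh⟩
    by_cases hy : y ∈ h
    · exact Or.inr ⟨h, hh, hy, hzh, hUh⟩
    · exact absurd hzh (hconv _ (hcompl hh) _ hx _ hy hz)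
  have disj : ∀ x y z, (∀ h ∈ halfspaces 𝓑, x ∈ h → y ∈ h → U h) → C x z → C y z → False := by
    rintro x y z hxy ⟨h, hh, hxh, hzh, hUh⟩ ⟨k, hk, hyk, hzk, hUk⟩
    have hyh : y ∉ h := fun h1 => hUh (hxy h hh hxh h1)
    have hxk : x ∉ k := fun h1 => hUk (hxy k hk h1 hyk)
    -- `h` and `k` share `z`, and each misses the point `y` or `x` of the other; nestedness then
    -- leaves only this inclusion. But `U` accepts `hᶜ` and rejects `k`.
    have hsub : hᶜ ⊆ k := by
      have hn : ∀ B ∈ 𝓑, ∀ B' ∈ 𝓑, B ⊆ B' ∨ B' ⊆ B ∨ B ⊆ B'ᶜ ∨ Bᶜ ⊆ B' := by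
        intro B hB B' hB'
        obtain ⟨Q, e, hB⟩ := hmem.1 hB
        obtain ⟨Q', e', hB'⟩ := hmem.1 hB'
        exact hB.nested hB'
      intro w hw
      by_contra hwk
      rcases hh with hh | hh <;> rcases hk with hk | hk <;> rcases hn _ hh _ hk with h1 | h1 | h1 | h1
      · exact hxk (h1 hxh)
      · exact hyh (h1 hyk)
      · exact h1 hzh hzk
      · exact hwk (h1 hw)
      · exact h1 hzh hzk
      · exact hwk (not_not.1 fun h2 => hw (h1 h2))
      · exact hxk (not_not.1 (h1 hxh))
      · exact h1 hyh hyk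
      · exact hwk (h1 hw)
      · exact h1 hzk hzh
      · exact hyh (not_not.1 fun h2 => h1 h2 hyk)
      · exact hxk (h1 (fun h2 => h2 hxh))
      · exact hyh (not_not.1 fun h2 => h1 h2 hyk)
      · exact hxk (not_not.1 fun h2 => h1 h2 hxh)
      · exact hwk (not_not.1 (h1 hw))
      · exact h1 (fun h2 => h2 hzh) hzk
    exact hUk (hmono _ (hcompl hh) _ hk hsub ((hU h hh).2 hUh))
  have hopen : ∀ x y z, (∀ h ∈ halfspaces 𝓑, x ∈ h → y ∈ h → U h) → z ∈ seg x y → C x z →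
      ∃ O : Set T, IsOpen O ∧ z ∈ O ∧ ∀ w ∈ O, w ∈ seg x y → C x w := by
    rintro x y z hxy hz ⟨h, hh | hh, hxh, hzh, hUh⟩
    · obtain ⟨Q, e, hB⟩ := hmem.1 hh
      refine ⟨h, ?_, hzh, fun w hw _ => ⟨h, Or.inl hh, hxh, hw, hUh⟩⟩
      obtain ⟨q, hq⟩ := hB.nonempty
      rw [hB.eq_branch hq]
      exact hT.isOpen_branch _ _ (hB.ne_of_mem hq)
    · obtain ⟨Q, e, hB⟩ := hmem.1 hh
      -- A complement of a branch is not a neighbourhood of its boundary point. There one moves on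
      -- to `m ∈ Q`: only the wall of `h` separates `m` from `e`, so `m` is still on the side of
      -- `x`.
      by_cases hze : z = e
      · subst hze
        have hyB : y ∈ hᶜ := fun h1 => hUh (hxy h (Or.inr hh) hxh h1)
        obtain ⟨m, hmQ, hm⟩ := hB.exists_btw_mem hT hP hyB
        have hms : m ∈ seg x y := seg_subset_right hz hm.mem_seg
        have hCm : C x m := by
          rcases cover x y m hms with h1 | ⟨k, hk, hyk, hmk, hUk⟩
          · exact h1
          · refine (disj x y z hxy ⟨h, Or.inr hh, hxh, hzh, hUh⟩ ⟨k, hk, hyk, ?_, hUk⟩).elim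
            rcases hk with hk | hk
            · obtain ⟨Q', e', hB'⟩ := hmem.1 hk
              by_contra hzk
              have := hB.eq_of_separates hT hP hB' hmQ (fun h => hzk (h.1 hmk))
              exact hUk (this ▸ (hU h (Or.inr hh)).2 hUh)
            · obtain ⟨Q', e', hB'⟩ := hmem.1 hk
              by_contra hzk
              have := hB.eq_of_separates hT hP hB' hmQ (fun h => h.2 hzk hmk)
              rw [← this] at hyB
              exact hyB hyk
        obtain ⟨k, hk, hxk, hmk, hUk⟩ := hCm
        refine ⟨branch m z, hT.isOpen_branch _ _ hm.ne_left.symm,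
          self_mem_branch hm.ne_left.symm, fun w hw hws => ⟨k, hk, hxk, ?_, hUk⟩⟩
        refine hconv k hk _ hxk _ hmk ?_
        rcases seg_subset_union _ _ m hws with h1 | h1
        · exact h1
        · have h2 : btw w m y := btw_of_mem_of_notMem_branch hm.ne_left.symm hw
            (fun h => h.2 hm) hm.ne_right.symm
          rcases h1 with h1 | h1 | h1
          · exact absurd h1 hw.1
          · exact absurd h1 h2.ne
          · exact absurd h2 h1.not_btw'
      · refine ⟨branch e z, hT.isOpen_branch _ _ hze, self_mem_branch hze,
          fun w hw _ => ⟨h, Or.inr hh, hxh, ?_, hUh⟩⟩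
        by_contra hwh
        have h1 := hB.eq_branch' (r := w) hwh
        rw [branch_eq_of_mem hze hw] at h1
        have h2 : z ∈ hᶜ := by
          rw [h1]
          exact self_mem_branch hze
        exact h2 hzh
  have hxy' : ∀ h ∈ halfspaces 𝓑, y ∈ h → x ∈ h → U h := fun h hh h1 h2 => hxy h hh h2 h1
  let V : T → T → Set T := fun x y => ⋃₀ {O | IsOpen O ∧ ∀ w ∈ O, w ∈ seg x y → C x w}
  have hV : ∀ x y, IsOpen (V x y) := fun x y => isOpen_sUnion fun O hO => hO.1
  have hxC : C x x := by
    rcases cover x y x (left_mem_seg _ _) with h | ⟨h, hh, h1, h2, h3⟩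
    · exact h
    · exact absurd (hxy h hh h2 h1) h3
  have hyC : C y y := by
    rcases cover x y y (right_mem_seg _ _) with ⟨h, hh, h1, h2, h3⟩ | h
    · exact absurd (hxy h hh h1 h2) h3
    · exact h
  have hVmem : ∀ x y z, (∀ h ∈ halfspaces 𝓑, x ∈ h → y ∈ h → U h) → z ∈ seg x y → C x z →
      z ∈ V x y := by
    intro x y z h1 h2 h3
    obtain ⟨O, hO, hz, hw⟩ := hopen x y z h1 h2 h3
    exact ⟨O, ⟨hO, hw⟩, hz⟩
  obtain ⟨z, hz, ⟨O, hO, hzO⟩, ⟨O', hO', hzO'⟩⟩ := hT.isPreconnected_seg x y _ _ (hV x y) (hV y x)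
    (fun z hz => (cover x y z hz).imp (hVmem x y z hxy hz)
      (hVmem y x z hxy' (by rwa [seg_comm])))
    ⟨x, left_mem_seg _ _, hVmem x y x hxy (left_mem_seg _ _) hxC⟩
    ⟨y, right_mem_seg _ _, hVmem y x y hxy' (left_mem_seg _ _) hyC⟩
  exact disj x y z hxy (hO.2 z hzO hz) (hO'.2 z hzO' (by rwa [seg_comm]))

theorem exists_wallSystem [ContinuousConstSMul G T] (hT : IsTreeTopology T) (hP : IsRTree T)
    (hover : NonOverlapping G T) (hnest : ActsNestingly G T) :
    ∃ bd : Set T → T, WallSystem G {B : Set T | ∃ Q e, IsWall G Q e B} bd ∧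
      ∀ B ∈ {B : Set T | ∃ Q e, IsWall G Q e B}, ∃ Q, IsWall G Q (bd B) B := by
  have hG : ∀ (g : G) (x y z : T), btw x y z → btw (g • x) (g • y) (g • z) := hT.btw_smul
  obtain ⟨Q₀, e₀, B₀, h₀⟩ := hover.exists_isWall hT hP hG hnest
  have : ∀ B : Set T, ∃ e, (∃ Q e, IsWall G Q e B) → ∃ Q, IsWall G Q e B := by
    intro B
    by_cases h : ∃ Q e, IsWall G Q e B
    · obtain ⟨Q, e, h⟩ := h
      exact ⟨e, fun _ => ⟨Q, h⟩⟩
    · exact ⟨e₀, fun h' => absurd h' h⟩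
  choose bd hbd using this
  refine ⟨bd, ?_, hbd⟩
  have hsmul : ∀ (g : G), ∀ B ∈ {B : Set T | ∃ Q e, IsWall G Q e B},
      g • B ∈ {B : Set T | ∃ Q e, IsWall G Q e B} := by
    rintro g B ⟨Q, e, h⟩
    exact ⟨_, _, h.smul hG g⟩
  constructor
  · exact ⟨B₀, Q₀, e₀, h₀⟩
  · rintro B ⟨Q, e, h⟩ B' ⟨Q', e', h'⟩
    exact h.nested h'
  · rintro B ⟨Q, e, h⟩ ⟨Q', e', h'⟩
    exact h.ne_compl hP h' rfl
  · intro B hB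
    obtain ⟨Q, h⟩ := hbd B hB
    exact h.notMem
  · intro B hB
    obtain ⟨Q, h⟩ := hbd B hB
    obtain ⟨q, hq⟩ := h.nonempty
    refine ⟨q, h.subset hq, ?_⟩
    rintro B' ⟨Q', e', h'⟩ hne
    by_contra hcon
    exact hne (h.eq_of_separates hT hP h' hq hcon)
  · rintro B ⟨Q, e, h⟩
    exact h.isConvex
  · rintro B ⟨Q, e, h⟩
    exact h.isConvex_compl
  · intro B hB x hx y hy
    obtain ⟨Q, h⟩ := hbd B hB
    exact h.mem_seg hx hy
  · exact hsmul
  · intro g B hB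
    obtain ⟨Q, h⟩ := hbd B hB
    obtain ⟨Q', h'⟩ := hbd _ (hsmul g B hB)
    exact (h'.unique hT hP (h.smul hG g)).1
  · exact fun U x y => IsWall.complete hT hP rfl U x y
  · exact fun R hR => IsWall.countable hT hP hR
  · intro g y B hB hg hy
    obtain ⟨Q, h⟩ := hbd B hB
    exact h.no_drift hT hP hg hy

end

/-! ### Consistent functions and the dual tree -/

section Dual

variable {T : Type*} {𝓑 : Set (Set T)} {h k B B' : Set T} {p p' x y z : T} {s t u v : Set T → ℝ}

theorem compl_mem_halfspaces (hh : h ∈ halfspaces 𝓑) : hᶜ ∈ halfspaces 𝓑 := by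
  rcases hh with h1 | h1
  · exact Or.inr (by rwa [compl_compl])
  · exact Or.inl h1

theorem mem_halfspaces (hB : B ∈ 𝓑) : B ∈ halfspaces 𝓑 := Or.inl hB

/-- A choice, possibly fractional, of sides of the walls that is compatible with inclusion of
half-spaces. -/
structure IsConsistent (𝓑 : Set (Set T)) (s : Set T → ℝ) : Prop where
  eq_zero_of_notMem : ∀ h ∉ halfspaces 𝓑, s h = 0
  nonneg : ∀ h, 0 ≤ s h
  compl : ∀ h ∈ halfspaces 𝓑, s hᶜ = 1 - s h
  -- A point even partly in `h` is wholly in every larger `k`, so it is interior to at most one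
  -- edge.
  eq_or_eq : ∀ h ∈ halfspaces 𝓑, ∀ k ∈ halfspaces 𝓑, h ⊆ k → h ≠ k → s h = 0 ∨ s k = 1

namespace IsConsistent

theorem le_one (hs : IsConsistent 𝓑 s) (h : Set T) : s h ≤ 1 := by
  by_cases hh : h ∈ halfspaces 𝓑
  · have h1 := hs.nonneg hᶜ
    rw [hs.compl h hh] at h1
    linarith
  · rw [hs.eq_zero_of_notMem h hh]
    exact zero_le_one

theorem eq_one_of_pos (hs : IsConsistent 𝓑 s) (hh : h ∈ halfspaces 𝓑) (hk : k ∈ halfspaces 𝓑)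
    (hsub : h ⊆ k) (hne : h ≠ k) (hpos : 0 < s h) : s k = 1 :=
  (hs.eq_or_eq h hh k hk hsub hne).resolve_left hpos.ne'

theorem apply_eq_sub (hs : IsConsistent 𝓑 s) (hh : h ∈ halfspaces 𝓑) : s h = 1 - s hᶜ := by
  rw [hs.compl h hh]
  ring

end IsConsistent

/-- The points `p` and `p'` are separated by no wall but that of `h`. -/
structure IsAdjacent (𝓑 : Set (Set T)) (h : Set T) (p p' : T) : Prop where
  mem_halfspaces : h ∈ halfspaces 𝓑
  mem : p ∈ h
  notMem : p' ∉ h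
  iff : ∀ k ∈ halfspaces 𝓑, k ≠ h → k ≠ hᶜ → (p ∈ k ↔ p' ∈ k)

theorem IsAdjacent.symm (ha : IsAdjacent 𝓑 h p p') : IsAdjacent 𝓑 hᶜ p' p where
  mem_halfspaces := compl_mem_halfspaces ha.mem_halfspaces
  mem := ha.notMem
  notMem := fun h' => h' ha.mem
  iff := fun k hk h1 h2 => (ha.iff k hk (by rwa [compl_compl] at h2) h1).symm

theorem compl_ne_self_of_mem (hp : p ∈ h) : hᶜ ≠ h := fun h' =>
  (h'.symm ▸ hp : p ∈ hᶜ) hp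

open Classical in
/-- The function taking the value `c` at `h` that elsewhere chooses the half-spaces
containing `p`. -/
noncomputable def wallFun (𝓑 : Set (Set T)) (h : Set T) (p : T) (c : ℝ) (k : Set T) : ℝ :=
  if k ∈ halfspaces 𝓑 then
    if k = h then c else if k = hᶜ then 1 - c else if p ∈ k then 1 else 0
  else 0

open Classical in
/-- The function choosing the half-spaces that contain `p`. -/
noncomputable def pointFun (𝓑 : Set (Set T)) (p : T) (k : Set T) : ℝ :=
  if k ∈ halfspaces 𝓑 ∧ p ∈ k then 1 else 0

theorem pointFun_of_mem (hk : k ∈ halfspaces 𝓑) (hp : p ∈ k) : pointFun 𝓑 p k = 1 :=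
  if_pos ⟨hk, hp⟩

theorem pointFun_of_notMem (hp : p ∉ k) : pointFun 𝓑 p k = 0 :=
  if_neg fun h => hp h.2

theorem isConsistent_pointFun (p : T) : IsConsistent 𝓑 (pointFun 𝓑 p) where
  eq_zero_of_notMem := fun h hh => if_neg fun h' => hh h'.1
  nonneg := fun h => by unfold pointFun; split_ifs <;> norm_num
  compl := fun h hh => by
    by_cases hp : p ∈ h
    · rw [pointFun_of_mem hh hp, pointFun_of_notMem (Set.notMem_compl_iff.2 hp), sub_self]
    · rw [pointFun_of_notMem hp, pointFun_of_mem (compl_mem_halfspaces hh) hp, sub_zero]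
  eq_or_eq := fun h _ k hk hsub _ => by
    by_cases hp : p ∈ h
    · exact Or.inr (pointFun_of_mem hk (hsub hp))
    · exact Or.inl (pointFun_of_notMem hp)

variable {c : ℝ}

theorem wallFun_of_notMem (hk : k ∉ halfspaces 𝓑) : wallFun 𝓑 h p c k = 0 := if_neg hk

theorem wallFun_self (hh : h ∈ halfspaces 𝓑) : wallFun 𝓑 h p c h = c := by
  simp [wallFun, hh]

theorem IsAdjacent.wallFun_compl (ha : IsAdjacent 𝓑 h p p') :
    wallFun 𝓑 h p c hᶜ = 1 - c := by
  simp [wallFun, compl_mem_halfspaces ha.mem_halfspaces, compl_ne_self_of_mem ha.mem]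

theorem wallFun_of_mem (hk : k ∈ halfspaces 𝓑) (h1 : k ≠ h) (h2 : k ≠ hᶜ) (hp : p ∈ k) :
    wallFun 𝓑 h p c k = 1 := by
  simp [wallFun, hk, h1, h2, hp]

theorem wallFun_of_notMem' (h1 : k ≠ h) (h2 : k ≠ hᶜ) (hp : p ∉ k) :
    wallFun 𝓑 h p c k = 0 := by
  simp [wallFun, h1, h2, hp]

/-- Any half-space of another wall contains both or neither of `p`, `p'`. One properly inside `h` or
`hᶜ` therefore misses them and gets value `0`; one properly containing either gets value `1`. -/
theorem IsAdjacent.isConsistent_wallFun (ha : IsAdjacent 𝓑 h p p') (h0 : 0 ≤ c) (h1 : c ≤ 1) :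
    IsConsistent 𝓑 (wallFun 𝓑 h p c) where
  eq_zero_of_notMem := fun k hk => wallFun_of_notMem hk
  nonneg := fun k => by
    unfold wallFun
    split_ifs <;> linarith
  compl := fun k hk => by
    by_cases hkh : k = h
    · subst hkh
      rw [ha.wallFun_compl, wallFun_self hk]
    by_cases hkh' : k = hᶜ
    · subst hkh'
      rw [compl_compl, ha.wallFun_compl, wallFun_self ha.mem_halfspaces]
      ring
    have e1 : kᶜ ≠ h := fun h => hkh' (by rw [← h, compl_compl])
    have e2 : kᶜ ≠ hᶜ := fun h => hkh (compl_injective h)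
    by_cases hp : p ∈ k
    · rw [wallFun_of_mem hk hkh hkh' hp, wallFun_of_notMem' e1 e2 (fun h => h hp), sub_self]
    · rw [wallFun_of_notMem' hkh hkh' hp, wallFun_of_mem (compl_mem_halfspaces hk) e1 e2 hp,
        sub_zero]
  eq_or_eq := fun k hk l hl hsub hne => by
    by_cases hkh : k = h
    · subst hkh
      exact Or.inr (wallFun_of_mem hl hne.symm
        (fun h => absurd ha.mem (h ▸ hsub ha.mem : p ∈ kᶜ)) (hsub ha.mem))
    by_cases hkh' : k = hᶜ
    · subst hkh'
      have e1 : l ≠ h := fun h => ha.notMem (h ▸ hsub ha.notMem)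
      exact Or.inr (wallFun_of_mem hl e1 hne.symm
        ((ha.iff l hl e1 hne.symm).2 (hsub ha.notMem)))
    by_cases hp : p ∈ k
    · have hp' := (ha.iff k hk hkh hkh').1 hp
      exact Or.inr (wallFun_of_mem hl (fun h => ha.notMem (h ▸ hsub hp'))
        (fun h => absurd ha.mem (h ▸ hsub hp : p ∈ _ᶜ)) (hsub hp))
    · exact Or.inl (wallFun_of_notMem' hkh hkh' hp)

theorem IsAdjacent.wallFun_one (ha : IsAdjacent 𝓑 h p p') :
    wallFun 𝓑 h p 1 = pointFun 𝓑 p := by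
  ext k
  by_cases hk : k ∈ halfspaces 𝓑
  swap
  · rw [wallFun_of_notMem hk, (isConsistent_pointFun p).eq_zero_of_notMem k hk]
  by_cases hkh : k = h
  · subst hkh
    rw [wallFun_self hk, pointFun_of_mem hk ha.mem]
  by_cases hkh' : k = hᶜ
  · subst hkh'
    rw [ha.wallFun_compl, pointFun_of_notMem (Set.notMem_compl_iff.2 ha.mem), sub_self]
  by_cases hp : p ∈ k
  · rw [wallFun_of_mem hk hkh hkh' hp, pointFun_of_mem hk hp]
  · rw [wallFun_of_notMem' hkh hkh' hp, pointFun_of_notMem hp]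

/-- A point of the dual tree: a consistent function that is fractional on some wall, or comes from
a point of `T`. -/
def IsDualPoint (𝓑 : Set (Set T)) (s : Set T → ℝ) : Prop :=
  IsConsistent 𝓑 s ∧ ((∃ h ∈ halfspaces 𝓑, 0 < s h ∧ s h < 1) ∨ ∃ x, s = pointFun 𝓑 x)

variable {G : Type*} [Group G] [Pretree T] [MulAction G T] {bd : Set T → T}

namespace WallSystem

theorem halfspaces_nested (W : WallSystem G 𝓑 bd) (hh : h ∈ halfspaces 𝓑)
    (hk : k ∈ halfspaces 𝓑) : h ⊆ k ∨ k ⊆ h ∨ h ⊆ kᶜ ∨ hᶜ ⊆ k := by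
  rcases hh with hh | hh <;> rcases hk with hk | hk <;> have := W.nested _ hh _ hk
  · exact this
  · rw [compl_compl] at this
    rcases this with h1 | h1 | h1 | h1
    · exact Or.inr (Or.inr (Or.inl h1))
    · exact Or.inr (Or.inr (Or.inr (Set.compl_subset_comm.1 h1)))
    · exact Or.inl h1
    · exact Or.inr (Or.inl (Set.compl_subset_compl.1 h1))
  · rw [compl_compl] at this
    rcases this with h1 | h1 | h1 | h1
    · exact Or.inr (Or.inr (Or.inr h1))
    · exact Or.inr (Or.inr (Or.inl (Set.subset_compl_comm.1 h1)))
    · exact Or.inr (Or.inl (Set.compl_subset_compl.1 h1))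
    · exact Or.inl h1
  · rw [compl_compl, compl_compl] at this
    rcases this with h1 | h1 | h1 | h1
    · exact Or.inr (Or.inl (Set.compl_subset_compl.1 h1))
    · exact Or.inl (Set.compl_subset_compl.1 h1)
    · exact Or.inr (Or.inr (Or.inr h1))
    · exact Or.inr (Or.inr (Or.inl h1))

theorem halfspaces_isConvex (W : WallSystem G 𝓑 bd) (hh : h ∈ halfspaces 𝓑) : IsConvex h := by
  rcases hh with hh | hh
  · exact W.isConvex _ hh
  · simpa using W.isConvex_compl _ hh

theorem exists_isAdjacent_bd (W : WallSystem G 𝓑 bd) (hB : B ∈ 𝓑) :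
    ∃ q, IsAdjacent 𝓑 B q (bd B) := by
  obtain ⟨q, hq, h1⟩ := W.exists_adjacent B hB
  refine ⟨q, mem_halfspaces hB, hq, W.bd_notMem B hB, ?_⟩
  rintro k (hk | hk) h2 h3
  · exact h1 k hk h2
  · exact not_iff_not.1 (h1 _ hk (fun h4 => h3 (by rw [← h4, compl_compl])))

theorem exists_isAdjacent (W : WallSystem G 𝓑 bd) (hh : h ∈ halfspaces 𝓑) :
    ∃ p p', IsAdjacent 𝓑 h p p' := by
  rcases hh with hh | hh
  · obtain ⟨q, hq⟩ := W.exists_isAdjacent_bd hh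
    exact ⟨_, _, hq⟩
  · obtain ⟨q, hq⟩ := W.exists_isAdjacent_bd hh
    have := hq.symm
    rw [compl_compl] at this
    exact ⟨_, _, this⟩

theorem subset_or_subset (W : WallSystem G 𝓑 bd) (ha : IsAdjacent 𝓑 h p p')
    (hk : k ∈ halfspaces 𝓑) (h1 : k ≠ h) (h2 : k ≠ hᶜ) (hp : p ∈ k) : h ⊆ k ∨ hᶜ ⊆ k := by
  rcases W.halfspaces_nested ha.mem_halfspaces hk with h3 | h3 | h3 | h3
  · exact Or.inl h3
  · exact absurd (h3 ((ha.iff k hk h1 h2).1 hp)) ha.notMem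
  · exact absurd hp (h3 ha.mem)
  · exact Or.inr h3

/-- At a fractional value both `h` and `hᶜ` are partly chosen, and `k` properly contains one of
them. The position on one edge thus fixes all other values. -/
theorem apply_eq_one (W : WallSystem G 𝓑 bd) (hs : IsConsistent 𝓑 s) (ha : IsAdjacent 𝓑 h p p')
    (h0 : 0 < s h) (h1 : s h < 1) (hk : k ∈ halfspaces 𝓑) (hkh : k ≠ h) (hkh' : k ≠ hᶜ)
    (hp : p ∈ k) : s k = 1 := by
  rcases W.subset_or_subset ha hk hkh hkh' hp with h2 | h2
  · exact hs.eq_one_of_pos ha.mem_halfspaces hk h2 hkh.symm h0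
  · refine hs.eq_one_of_pos (compl_mem_halfspaces ha.mem_halfspaces) hk h2 hkh'.symm ?_
    rw [hs.compl h ha.mem_halfspaces]
    linarith

theorem apply_eq_zero (W : WallSystem G 𝓑 bd) (hs : IsConsistent 𝓑 s) (ha : IsAdjacent 𝓑 h p p')
    (h0 : 0 < s h) (h1 : s h < 1) (hk : k ∈ halfspaces 𝓑) (hkh : k ≠ h) (hkh' : k ≠ hᶜ)
    (hp : p ∉ k) : s k = 0 := by
  rw [hs.apply_eq_sub hk, W.apply_eq_one hs ha h0 h1 (compl_mem_halfspaces hk)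
    (fun h => hkh' (by rw [← h, compl_compl])) (fun h => hkh (compl_injective h)) hp, sub_self]

end WallSystem

/-- Every other half-space containing `p` contains `h`, where `t` is positive, or `hᶜ`, where `s`
is. So one of `s`, `t` already has the value `1` there. This produces points on the segments of the
dual tree. -/
theorem WallSystem.wallFun_mem_uIcc (W : WallSystem G 𝓑 bd) (hs : IsConsistent 𝓑 s)
    (ht : IsConsistent 𝓑 t) (ha : IsAdjacent 𝓑 h p p') (hst : s h < t h) (h1 : s h ≤ c)
    (h2 : c ≤ t h) (k : Set T) : wallFun 𝓑 h p c k ∈ Set.uIcc (s k) (t k) := by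
  by_cases hk : k ∈ halfspaces 𝓑
  swap
  · rw [wallFun_of_notMem hk, hs.eq_zero_of_notMem k hk, ht.eq_zero_of_notMem k hk]
    exact Set.left_mem_uIcc
  by_cases hkh : k = h
  · subst hkh
    rw [wallFun_self hk, Set.mem_uIcc]
    exact Or.inl ⟨h1, h2⟩
  by_cases hkh' : k = hᶜ
  · subst hkh'
    rw [ha.wallFun_compl, hs.compl _ ha.mem_halfspaces, ht.compl _ ha.mem_halfspaces, Set.mem_uIcc]
    right
    constructor <;> linarith
  have key : ∀ l ∈ halfspaces 𝓑, l ≠ h → l ≠ hᶜ → p ∈ l → s l = 1 ∨ t l = 1 := by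
    intro l hl h3 h4 hpl
    rcases W.subset_or_subset ha hl h3 h4 hpl with h5 | h5
    · exact Or.inr (ht.eq_one_of_pos ha.mem_halfspaces hl h5 h3.symm
        ((hs.nonneg h).trans_lt hst))
    · refine Or.inl (hs.eq_one_of_pos (compl_mem_halfspaces ha.mem_halfspaces) hl h5 h4.symm ?_)
      rw [hs.compl _ ha.mem_halfspaces]
      have := ht.le_one h
      linarith
  by_cases hp : p ∈ k
  · rw [wallFun_of_mem hk hkh hkh' hp]
    rcases key k hk hkh hkh' hp with h3 | h3
    · rw [h3]
      exact Set.left_mem_uIcc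
    · rw [h3]
      exact Set.right_mem_uIcc
  · rw [wallFun_of_notMem' hkh hkh' hp]
    rcases key kᶜ (compl_mem_halfspaces hk) (fun h => hkh' (by rw [← h, compl_compl]))
      (fun h => hkh (compl_injective h)) hp with h3 | h3
    · rw [hs.apply_eq_sub hk, h3, sub_self]
      exact Set.left_mem_uIcc
    · rw [ht.apply_eq_sub hk, h3, sub_self]
      exact Set.right_mem_uIcc

theorem WallSystem.eq_wallFun (W : WallSystem G 𝓑 bd) (hs : IsConsistent 𝓑 s)
    (ha : IsAdjacent 𝓑 h p p') (h0 : 0 < s h) (h1 : s h < 1) : s = wallFun 𝓑 h p (s h) := by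
  ext k
  by_cases hk : k ∈ halfspaces 𝓑
  swap
  · rw [wallFun_of_notMem hk, hs.eq_zero_of_notMem k hk]
  by_cases hkh : k = h
  · subst hkh
    rw [wallFun_self hk]
  by_cases hkh' : k = hᶜ
  · subst hkh'
    rw [ha.wallFun_compl, hs.compl _ ha.mem_halfspaces]
  by_cases hp : p ∈ k
  · rw [wallFun_of_mem hk hkh hkh' hp, W.apply_eq_one hs ha h0 h1 hk hkh hkh' hp]
  · rw [wallFun_of_notMem' hkh hkh' hp, W.apply_eq_zero hs ha h0 h1 hk hkh hkh' hp]

/-- A consistent function that is nowhere fractional is a coherent choice of sides; completeness of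
the wall system realises it by a point of `T`. -/
theorem WallSystem.isDualPoint_of_mem_uIcc (W : WallSystem G 𝓑 bd) (hs : IsDualPoint 𝓑 s)
    (ht : IsDualPoint 𝓑 t) (hu : IsConsistent 𝓑 u) (hst : ∀ h, u h ∈ Set.uIcc (s h) (t h)) :
    IsDualPoint 𝓑 u := by
  refine ⟨hu, ?_⟩
  by_contra! hcon
  obtain ⟨hfrac, hpt⟩ := hcon
  have h01 : ∀ h ∈ halfspaces 𝓑, u h ≠ 1 → u h = 0 := by
    intro h hh h1
    by_contra h0
    have h2 := hfrac h hh (lt_of_le_of_ne (hu.nonneg h) (Ne.symm h0))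
    exact h1 (le_antisymm (hu.le_one h) h2)
  -- A fractional `s` is replaced by an end vertex of its edge, which suffices to bound the choice
  -- of sides.
  have key : ∀ s, IsDualPoint 𝓑 s → ∃ x, ∀ h ∈ halfspaces 𝓑, x ∈ h → 0 < s h := by
    rintro s ⟨hs, ⟨h, hh, h0, h1⟩ | ⟨x, rfl⟩⟩
    · obtain ⟨p, p', ha⟩ := W.exists_isAdjacent hh
      refine ⟨p, fun k hk hp => ?_⟩
      by_cases hkh : k = h
      · rwa [hkh]
      by_cases hkh' : k = hᶜ
      · rw [hkh', hs.compl h hh]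
        linarith
      rw [W.apply_eq_one hs ha h0 h1 hk hkh hkh' hp]
      exact one_pos
    · refine ⟨x, fun h hh hx => ?_⟩
      rw [pointFun_of_mem hh hx]
      exact one_pos
  obtain ⟨x, hx⟩ := key s hs
  obtain ⟨y, hy⟩ := key t ht
  obtain ⟨z, hz⟩ := W.complete (fun h => u h = 1) x y (fun h hh => by
      rw [hu.compl h hh]
      constructor
      · intro h1 h2
        rw [h2] at h1
        norm_num at h1
      · intro h1
        rw [h01 h hh h1, sub_zero])
    (fun h hh k hk hsub h1 => by
      by_cases hne : h = k
      · rwa [← hne]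
      · exact hu.eq_one_of_pos hh hk hsub hne (h1 ▸ one_pos))
    (fun h hh h1 h2 => by
      by_contra h3
      have h4 := hst h
      rw [h01 h hh h3, Set.mem_uIcc] at h4
      have h5 := hx h hh h1
      have h6 := hy h hh h2
      rcases h4 with h4 | h4
      · linarith [h4.1]
      · linarith [h4.1])
  refine hpt z (funext fun h => ?_)
  by_cases hh : h ∈ halfspaces 𝓑
  · by_cases hzh : z ∈ h
    · rw [pointFun_of_mem hh hzh]
      exact (hz h hh).1 hzh
    · rw [pointFun_of_notMem hzh]
      exact h01 h hh (fun h1 => hzh ((hz h hh).2 h1))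
  · rw [hu.eq_zero_of_notMem h hh, (isConsistent_pointFun z).eq_zero_of_notMem h hh]

/-- The dual tree of a system of walls. -/
structure Dual (_ : WallSystem G 𝓑 bd) where
  toFun : Set T → ℝ
  isDualPoint : IsDualPoint 𝓑 toFun

namespace Dual

variable {W : WallSystem G 𝓑 bd}

instance : CoeFun (Dual W) fun _ => Set T → ℝ := ⟨Dual.toFun⟩

theorem isConsistent (s : Dual W) : IsConsistent 𝓑 s := s.isDualPoint.1

theorem ext {s t : Dual W} (h : ∀ k, s k = t k) : s = t := by
  cases s
  cases t
  congr
  exact funext h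

theorem ext_of_wall {s t : Dual W} (h : ∀ B ∈ 𝓑, s B = t B) : s = t := by
  refine ext fun k => ?_
  by_cases hk : k ∈ halfspaces 𝓑
  · obtain hk' | hk' := id hk
    · exact h k hk'
    · rw [s.isConsistent.apply_eq_sub hk, t.isConsistent.apply_eq_sub hk, h _ hk']
  · rw [s.isConsistent.eq_zero_of_notMem k hk, t.isConsistent.eq_zero_of_notMem k hk]

/-- Passing to the complement turns exceeding both ends into lying below both. -/
theorem exists_lt_of_notMem {s u w : Dual W} (h : ∃ h, u h ∉ Set.uIcc (s h) (w h)) :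
    ∃ h ∈ halfspaces 𝓑, u h < s h ∧ u h < w h := by
  obtain ⟨h, hu⟩ := h
  by_cases hh : h ∈ halfspaces 𝓑
  · rw [Set.mem_uIcc] at hu
    push Not at hu
    rcases lt_or_ge (u h) (s h) with h1 | h1
    · rcases lt_or_ge (u h) (w h) with h2 | h2
      · exact ⟨h, hh, h1, h2⟩
      · exact absurd h1 (hu.2 h2).not_gt
    · have h2 := hu.1 h1
      have h3 : s h < u h := by
        rcases h1.eq_or_lt with h3 | h3
        · exact absurd h3.symm.le (hu.2 h2.le).not_ge
        · exact h3
      refine ⟨hᶜ, compl_mem_halfspaces hh, ?_, ?_⟩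
      · rw [u.isConsistent.compl h hh, s.isConsistent.compl h hh]
        linarith
      · rw [u.isConsistent.compl h hh, w.isConsistent.compl h hh]
        linarith
  · rw [u.isConsistent.eq_zero_of_notMem h hh, s.isConsistent.eq_zero_of_notMem h hh,
      w.isConsistent.eq_zero_of_notMem h hh] at hu
    simp at hu

/-- Betweenness is coordinatewise. Only the last axiom needs nestedness of the half-spaces. -/
instance : Pretree (Dual W) where
  btw s u t := u ≠ s ∧ u ≠ t ∧ ∀ h, u h ∈ Set.uIcc (s h) (t h)
  not_btw_self s u hu := hu.1 (ext fun k => by simpa using hu.2.2 k)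
  btw_symm s t u := by
    simp only [Set.uIcc_comm]
    tauto
  btw_asymm s t u hu ht := by
    refine hu.2.1 (ext fun k => ?_)
    have h1 := hu.2.2 k
    have h2 := ht.2.2 k
    rw [Set.mem_uIcc] at h1 h2
    rcases h1 with h1 | h1 <;> rcases h2 with h2 | h2 <;> linarith
  btw_or s t u w hu hw := by
    by_contra! hcon
    obtain ⟨hs, ht⟩ := hcon
    obtain ⟨h, hh, h1, h2⟩ := exists_lt_of_notMem (hs hu.1 hw)
    obtain ⟨k, hk, h3, h4⟩ := exists_lt_of_notMem (ht hu.2.1 hw)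
    have h5 : t h ≤ u h := by
      have := hu.2.2 h
      rw [Set.mem_uIcc] at this
      rcases this with h6 | h6 <;> linarith
    have h6 : s k ≤ u k := by
      have := hu.2.2 k
      rw [Set.mem_uIcc] at this
      rcases this with h6 | h6 <;> linarith
    have cs := s.isConsistent
    have ct := t.isConsistent
    have cu := u.isConsistent
    have cw := w.isConsistent
    by_cases hhk : h = k
    · subst hhk
      linarith
    by_cases hhk' : h = kᶜ
    · rw [hhk', cu.compl k hk, cw.compl k hk] at h2
      linarith
    -- Here `t h ≤ u h < s h, w h` and `s k ≤ u k < t k, w k`. Each nesting of `h` and `k` forces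
    -- some value to be `1` against these inequalities.
    rcases W.halfspaces_nested hh hk with h7 | h7 | h7 | h7
    · have := cs.eq_one_of_pos hh hk h7 hhk (by linarith [cu.nonneg h])
      linarith [ct.le_one k]
    · have := ct.eq_one_of_pos hk hh h7 (Ne.symm hhk) (by linarith [cu.nonneg k])
      linarith [cs.le_one h]
    · have := cw.eq_one_of_pos hh (compl_mem_halfspaces hk) h7 hhk' (by linarith [cu.nonneg h])
      rw [cw.compl k hk] at this
      linarith [cu.nonneg k]
    · have := cu.eq_one_of_pos (compl_mem_halfspaces hh) hk h7
        (fun h => hhk' (by rw [← h, compl_compl])) (by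
          rw [cu.compl h hh]
          linarith [cw.le_one h])
      linarith [ct.le_one k]

theorem mem_seg_iff {s t u : Dual W} : u ∈ seg s t ↔ ∀ h, u h ∈ Set.uIcc (s h) (t h) := by
  constructor
  · rintro (rfl | rfl | h)
    · exact fun _ => Set.left_mem_uIcc
    · exact fun _ => Set.right_mem_uIcc
    · exact h.2.2
  · intro h
    by_cases h1 : u = s
    · exact Or.inl h1
    by_cases h2 : u = t
    · exact Or.inr (Or.inl h2)
    exact Or.inr (Or.inr ⟨h1, h2, h⟩)

/-- The point of the dual tree given by a point of `T`. -/
noncomputable def ofPoint (W : WallSystem G 𝓑 bd) (x : T) : Dual W :=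
  ⟨pointFun 𝓑 x, isConsistent_pointFun x, Or.inr ⟨x, rfl⟩⟩

theorem exists_mem_seg {s t : Dual W} (hh : h ∈ halfspaces 𝓑) {c : ℝ} (hst : s h < t h)
    (h1 : s h ≤ c) (h2 : c ≤ t h) : ∃ u ∈ seg s t, u h = c := by
  obtain ⟨p, p', ha⟩ := W.exists_isAdjacent hh
  have hc := W.wallFun_mem_uIcc s.isConsistent t.isConsistent ha hst h1 h2
  refine ⟨⟨wallFun 𝓑 h p c, W.isDualPoint_of_mem_uIcc s.isDualPoint t.isDualPoint
    (ha.isConsistent_wallFun ((s.isConsistent.nonneg h).trans h1)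
      (h2.trans (t.isConsistent.le_one h))) hc⟩, mem_seg_iff.2 hc, wallFun_self hh⟩

theorem exists_wall_lt_or_gt {s t : Dual W} (hst : s ≠ t) : ∃ B ∈ 𝓑, s B ≠ t B := by
  by_contra! h
  exact hst (ext_of_wall h)

theorem exists_frac_mem_seg {s t : Dual W} {B : Set T} (hB : B ∈ 𝓑) (hst : s B ≠ t B) :
    ∃ u ∈ seg s t, 0 < u B ∧ u B < 1 ∧ u ≠ s ∧ u ≠ t := by
  have key : ∀ s t : Dual W, s B < t B → ∃ u ∈ seg s t, 0 < u B ∧ u B < 1 ∧ u ≠ s ∧ u ≠ t := by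
    intro s t h
    obtain ⟨u, hu, hc⟩ := exists_mem_seg (mem_halfspaces hB) h (c := (s B + t B) / 2)
      (by linarith) (by linarith)
    have h1 := s.isConsistent.nonneg B
    have h2 := t.isConsistent.le_one B
    refine ⟨u, hu, by linarith, by linarith, ?_, ?_⟩
    · rintro rfl
      linarith
    · rintro rfl
      linarith
  rcases hst.lt_or_gt with h | h
  · exact key s t h
  · obtain ⟨u, hu, h1, h2, h3, h4⟩ := key t s h
    exact ⟨u, by rwa [seg_comm], h1, h2, h4, h3⟩

theorem exists_btw {s t : Dual W} (hst : s ≠ t) : ∃ u, btw s u t := by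
  obtain ⟨B, hB, h⟩ := exists_wall_lt_or_gt hst
  obtain ⟨u, hu, -, -, h1, h2⟩ := exists_frac_mem_seg hB h
  exact ⟨u, h1, h2, mem_seg_iff.1 hu⟩

/-- An interior point of the edge of `B` lies on the same side of every other wall as `bd B`. -/
theorem apply_eq_one_of_bd_mem {u : Dual W} (hB : B ∈ 𝓑) (hB' : B' ∈ 𝓑) (hne : B' ≠ B)
    (h0 : 0 < u B) (h1 : u B < 1) (h : bd B ∈ B') : u B' = 1 := by
  obtain ⟨q, hq⟩ := W.exists_isAdjacent_bd hB
  have hne' : B' ≠ Bᶜ := fun h => W.compl_notMem B hB (h ▸ hB')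
  exact W.apply_eq_one u.isConsistent hq h0 h1 (mem_halfspaces hB') hne hne'
    ((hq.iff B' (mem_halfspaces hB') hne hne').2 h)

theorem apply_eq_zero_of_bd_notMem {u : Dual W} (hB : B ∈ 𝓑) (hB' : B' ∈ 𝓑) (hne : B' ≠ B)
    (h0 : 0 < u B) (h1 : u B < 1) (h : bd B ∉ B') : u B' = 0 := by
  obtain ⟨q, hq⟩ := W.exists_isAdjacent_bd hB
  have hne' : B' ≠ Bᶜ := fun h => W.compl_notMem B hB (h ▸ hB')
  exact W.apply_eq_zero u.isConsistent hq h0 h1 (mem_halfspaces hB') hne hne'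
    (fun h' => h ((hq.iff B' (mem_halfspaces hB') hne hne').1 h'))

/-- A point of the dual tree is fractional on at most one wall. -/
theorem wall_unique {u : Dual W} (hB : B ∈ 𝓑) (hB' : B' ∈ 𝓑) (h0 : 0 < u B) (h1 : u B < 1)
    (h0' : 0 < u B') (h1' : u B' < 1) : B' = B := by
  by_contra hne
  by_cases h : bd B ∈ B'
  · exact h1'.ne (apply_eq_one_of_bd_mem hB hB' hne h0 h1 h)
  · exact h0'.ne' (apply_eq_zero_of_bd_notMem hB hB' hne h0 h1 h)

theorem eq_of_apply_eq {u v : Dual W} (hB : B ∈ 𝓑) (h0 : 0 < u B) (h1 : u B < 1)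
    (h : u B = v B) : u = v := by
  obtain ⟨q, hq⟩ := W.exists_isAdjacent_bd hB
  refine ext fun k => ?_
  rw [W.eq_wallFun u.isConsistent hq h0 h1, W.eq_wallFun v.isConsistent hq (h ▸ h0) (h ▸ h1), h]

/-- This carries order from the dual tree to `T`: were the outer boundary points on one side of
`B₂`, then `u₁` and `u₃` would agree there with value `0` or `1`, forcing that value on `u₂`. -/
theorem separates_of_btw {B₁ B₂ B₃ : Set T} {u₁ u₂ u₃ : Dual W} (h : btw u₁ u₂ u₃) (hB₁ : B₁ ∈ 𝓑)
    (hB₂ : B₂ ∈ 𝓑) (hB₃ : B₃ ∈ 𝓑) (h12 : B₂ ≠ B₁) (h23 : B₂ ≠ B₃)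
    (hu₁ : 0 < u₁ B₁ ∧ u₁ B₁ < 1) (hu₂ : 0 < u₂ B₂ ∧ u₂ B₂ < 1)
    (hu₃ : 0 < u₃ B₃ ∧ u₃ B₃ < 1) : ¬ (bd B₁ ∈ B₂ ↔ bd B₃ ∈ B₂) := by
  intro hiff
  have h1 := h.2.2 B₂
  by_cases hm : bd B₁ ∈ B₂
  · rw [apply_eq_one_of_bd_mem hB₁ hB₂ h12 hu₁.1 hu₁.2 hm,
      apply_eq_one_of_bd_mem hB₃ hB₂ h23 hu₃.1 hu₃.2 (hiff.1 hm), Set.uIcc_self] at h1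
    exact hu₂.2.ne h1
  · rw [apply_eq_zero_of_bd_notMem hB₁ hB₂ h12 hu₁.1 hu₁.2 hm,
      apply_eq_zero_of_bd_notMem hB₃ hB₂ h23 hu₃.1 hu₃.2 (fun h => hm (hiff.2 h)),
      Set.uIcc_self] at h1
    exact hu₂.1.ne' h1

theorem bd_mem_seg_of_separates (W : WallSystem G 𝓑 bd) (hB : B ∈ 𝓑)
    (h : ¬ (x ∈ B ↔ y ∈ B)) : bd B ∈ seg x y := by
  by_cases hx : x ∈ B
  · exact W.bd_mem_seg B hB x hx y fun hy => h ⟨fun _ => hy, fun _ => hx⟩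
  · by_cases hy : y ∈ B
    · rw [seg_comm]
      exact W.bd_mem_seg B hB y hy x hx
    · exact absurd (iff_of_false hx hy) h

end Dual

end Dual

/-! ### Linear subsets of the dual tree are real intervals -/

/-- A linear set with an additive distance for which segments have all intermediate points is a
real interval. -/
theorem Pretree.isRealInterval_of_dist {P : Type*} [Pretree P] {L : Set P} (hL : IsLinear L)
    (d : P → P → ℝ) (hd0 : ∀ x, d x x = 0) (hsymm : ∀ x y, d x y = d y x)
    (hpos : ∀ x ∈ L, ∀ y ∈ L, x ≠ y → 0 < d x y)
    (hadd : ∀ x ∈ L, ∀ y ∈ L, ∀ z ∈ L, btw x y z → d x z = d x y + d y z)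
    (hivt : ∀ x ∈ L, ∀ y ∈ L, ∀ c, 0 ≤ c → c ≤ d x y → ∃ z ∈ L, z ∈ seg x y ∧ d x z = c) :
    IsRealInterval L := by
  by_cases hsub : L.Subsingleton
  · refine ⟨fun _ => 0, fun x hx y hy _ => hsub hx hy, ?_, fun x hx y hy z hz => ?_⟩
    · refine ⟨fun u hu v hv t ht => ?_⟩
      obtain rfl := hsub.image _ hu hv
      rwa [le_antisymm ht.2 ht.1]
    · simp only [lt_self_iff_false, and_self, or_self, iff_false]
      exact fun h => h.ne (hsub hx hz)
  rw [Set.not_subsingleton_iff] at hsub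
  obtain ⟨a, ha, b, hb, hab⟩ := hsub
  classical
  have hnn : ∀ x ∈ L, ∀ y ∈ L, 0 ≤ d x y := by
    intro x hx y hy
    by_cases h : x = y
    · rw [h, hd0]
    · exact (hpos x hx y hy h).le
  -- Signed distance from `a`, negative on the side of `a` away from `b`.
  let f : P → ℝ := fun s => if btw s a b then - d a s else d a s
  have hf1 : ∀ s, btw s a b → f s = - d a s := fun s hs => if_pos hs
  have hf2 : ∀ s, ¬ btw s a b → f s = d a s := fun s hs => if_neg hs
  have hsame : ∀ s ∈ L, ∀ t ∈ L, ¬ btw s a t → |d a s - d a t| = d s t := by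
    intro s hs t ht h
    by_cases hst : s = t
    · rw [hst, hd0, sub_self, abs_zero]
    by_cases has : a = s
    · rw [← has, hd0, zero_sub, abs_neg, abs_of_nonneg (hnn a ha t ht)]
    by_cases hat : a = t
    · rw [← hat, hd0, sub_zero, abs_of_nonneg (hnn a ha s hs), hsymm]
    rcases hL a ha s hs t ht has hst hat with h1 | h1 | h1
    · rw [hadd a ha s hs t ht h1, sub_add_cancel_left, abs_neg, abs_of_nonneg (hnn s hs t ht)]
    · rw [hadd a ha t ht s hs h1.symm, add_sub_cancel_left, abs_of_nonneg (hnn t ht s hs), hsymm]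
    · exact absurd h1.symm h
  have hopp : ∀ s ∈ L, ∀ t ∈ L, btw t a b → ¬ btw s a b → |d a s + d a t| = d s t := by
    intro s hs t ht h1 h2
    rw [abs_of_nonneg (add_nonneg (hnn a ha s hs) (hnn a ha t ht))]
    by_cases has : a = s
    · rw [← has, hd0, zero_add]
    rcases h1.or has with h3 | h3
    · rw [hadd s hs a ha t ht h3.symm, hsymm a s]
    · exact absurd h3.symm h2
  have hiso : ∀ s ∈ L, ∀ t ∈ L, |f s - f t| = d s t := by
    intro s hs t ht
    by_cases h1 : btw s a b <;> by_cases h2 : btw t a b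
    · rw [hf1 s h1, hf1 t h2, ← hsame s hs t ht, neg_sub_neg, abs_sub_comm]
      exact fun h3 => hL.not_tripod hs ht hb h3 h2 h1
    · rw [hf1 s h1, hf2 t h2, hsymm s t, ← hopp t ht s hs h1 h2, ← abs_neg]
      ring_nf
    · rw [hf2 s h1, hf1 t h2, ← hopp s hs t ht h2 h1, sub_neg_eq_add]
    · rw [hf2 s h1, hf2 t h2]
      refine hsame s hs t ht fun h3 => ?_
      rcases h3.or hab with h4 | h4
      · exact h1 h4
      · exact h2 h4
  have hinj : Set.InjOn f L := by
    intro x hx y hy hxy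
    by_contra hne
    have h1 := hpos x hx y hy hne
    rw [← hiso x hx y hy, hxy, sub_self, abs_zero] at h1
    exact lt_irrefl _ h1
  have hfwd : ∀ x ∈ L, ∀ y ∈ L, ∀ z ∈ L, btw x y z →
      (f x < f y ∧ f y < f z) ∨ (f z < f y ∧ f y < f x) := by
    intro x hx y hy z hz h
    have h1 := hadd x hx y hy z hz h
    rw [← hiso x hx y hy, ← hiso y hy z hz, ← hiso x hx z hz] at h1
    have h2 : f x ≠ f y := fun h' => h.ne_left (hinj hx hy h').symm
    have h3 : f y ≠ f z := fun h' => h.ne_right (hinj hy hz h')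
    rcases h2.lt_or_gt with h2 | h2 <;> rcases h3.lt_or_gt with h3 | h3
    · exact Or.inl ⟨h2, h3⟩
    · rw [abs_of_neg (sub_neg.2 h2), abs_of_pos (sub_pos.2 h3)] at h1
      rcases abs_cases (f x - f z) with h4 | h4 <;> linarith
    · rw [abs_of_pos (sub_pos.2 h2), abs_of_neg (sub_neg.2 h3)] at h1
      rcases abs_cases (f x - f z) with h4 | h4 <;> linarith
    · exact Or.inr ⟨h3, h2⟩
  refine ⟨f, hinj, ?_, fun x hx y hy z hz => ⟨hfwd x hx y hy z hz, fun h => ?_⟩⟩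
  · refine ⟨?_⟩
    rintro _ ⟨x, hx, rfl⟩ _ ⟨y, hy, rfl⟩ t ⟨ht1, ht2⟩
    have h1 := hiso x hx y hy
    rw [abs_sub_comm, abs_of_nonneg (by linarith)] at h1
    obtain ⟨z, hz, hzs, hzd⟩ := hivt x hx y hy (t - f x) (by linarith) (by linarith)
    have h2 : d x y = d x z + d z y := by
      rcases hzs with rfl | rfl | h
      · rw [hd0, zero_add]
      · rw [hd0, add_zero]
      · exact hadd x hx z hz y hy h
    have h3 := hiso x hx z hz
    have h4 := hiso z hz y hy
    refine ⟨z, hz, ?_⟩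
    rcases abs_cases (f x - f z) with h5 | h5 <;> rcases abs_cases (f z - f y) with h6 | h6 <;>
      linarith
  · have hxy : x ≠ y := by
      rintro rfl
      rcases h with h | h
      · exact lt_irrefl _ h.1
      · exact lt_irrefl _ h.2
    have hyz : y ≠ z := by
      rintro rfl
      rcases h with h | h
      · exact lt_irrefl _ h.2
      · exact lt_irrefl _ h.1
    have hxz : x ≠ z := by
      rintro rfl
      rcases h with h | h
      · exact lt_asymm h.1 h.2
      · exact lt_asymm h.1 h.2
    rcases hL x hx y hy z hz hxy hyz hxz with h1 | h1 | h1
    · exact h1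
    · rcases hfwd y hy z hz x hx h1 with h2 | h2 <;> rcases h with h | h <;> linarith
    · rcases hfwd z hz x hx y hy h1 with h2 | h2 <;> rcases h with h | h <;> linarith

theorem isClosed_isConsistent {T : Type*} (𝓑 : Set (Set T)) :
    IsClosed {s : Set T → ℝ | IsConsistent 𝓑 s} := by
  have : {s : Set T → ℝ | IsConsistent 𝓑 s} =
      (⋂ h ∈ (halfspaces 𝓑)ᶜ, {s | s h = 0}) ∩ (⋂ h, {s | 0 ≤ s h}) ∩
      (⋂ h ∈ halfspaces 𝓑, {s | s hᶜ = 1 - s h}) ∩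
      (⋂ h ∈ halfspaces 𝓑, ⋂ k ∈ halfspaces 𝓑, ⋂ (_ : h ⊆ k), ⋂ (_ : h ≠ k),
        ({s | s h = 0} ∪ {s | s k = 1})) := by
    ext s
    simp only [Set.mem_inter_iff, Set.mem_iInter]
    exact ⟨fun h => ⟨⟨⟨h.1, h.2⟩, h.3⟩, h.4⟩, fun h => ⟨h.1.1.1, h.1.1.2, h.1.2, h.2⟩⟩
  rw [this]
  refine ((IsClosed.inter ?_ ?_).inter ?_).inter ?_
  · exact isClosed_biInter fun h _ => isClosed_eq (continuous_apply h) continuous_const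
  · exact isClosed_iInter fun h => isClosed_le continuous_const (continuous_apply h)
  · exact isClosed_biInter fun h _ => isClosed_eq (continuous_apply _)
      (continuous_const.sub (continuous_apply h))
  · refine isClosed_biInter fun h _ => isClosed_biInter fun k _ => isClosed_iInter fun _ =>
      isClosed_iInter fun _ => ?_
    exact (isClosed_eq (continuous_apply h) continuous_const).union
      (isClosed_eq (continuous_apply k) continuous_const)

namespace Dual

section wdist

variable {T : Type*} {𝓑 : Set (Set T)} {w : Set T → ℝ}

/-- Weighted distance between functions on the half-spaces. -/
noncomputable def wdist (w : Set T → ℝ) (s t : Set T → ℝ) : ℝ := ∑' h, w h * |s h - t h|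

theorem summable_wdist (hw : Summable w) (hw0 : ∀ h, 0 ≤ w h) {s t : Set T → ℝ}
    (hs : IsConsistent 𝓑 s) (ht : IsConsistent 𝓑 t) : Summable fun h => w h * |s h - t h| := by
  refine Summable.of_nonneg_of_le (fun h => mul_nonneg (hw0 h) (abs_nonneg _)) (fun h => ?_) hw
  refine mul_le_of_le_one_right (hw0 h) (abs_le.2 ⟨?_, ?_⟩)
  · linarith [hs.nonneg h, ht.le_one h]
  · linarith [ht.nonneg h, hs.le_one h]

theorem wdist_self (s : Set T → ℝ) : wdist w s s = 0 := by simp [wdist]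

theorem wdist_comm (s t : Set T → ℝ) : wdist w s t = wdist w t s := by
  simp only [wdist, abs_sub_comm]

end wdist

variable {G T : Type*} [Group G] [Pretree T] [MulAction G T] {𝓑 : Set (Set T)} {bd : Set T → T}
  {W : WallSystem G 𝓑 bd} {L : Set (Dual W)}

/-- The walls crossed by a set of points of the dual tree. -/
def crossed (L : Set (Dual W)) : Set (Set T) := {B ∈ 𝓑 | ∃ s ∈ L, ∃ t ∈ L, s B ≠ t B}

/-- An interior point `u B` is chosen on each crossed edge. The order of these points makes the set
`R` of boundary points linear in `T`, and `W.countable` handles the walls that separate points of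
`R`. -/
theorem countable_crossed (hL : IsLinear L) (hconv : IsConvex L) : (crossed L).Countable := by
  have : ∀ B, ∃ u : Dual W, B ∈ crossed L → u ∈ L ∧ 0 < u B ∧ u B < 1 := by
    intro B
    by_cases h : B ∈ crossed L
    · obtain ⟨hB, s, hs, t, ht, hst⟩ := h
      obtain ⟨u, hu, h1, h2, -⟩ := exists_frac_mem_seg hB hst
      exact ⟨u, fun _ => ⟨hconv s hs t ht hu, h1, h2⟩⟩
    · obtain ⟨B₀, hB₀⟩ := W.nonempty
      exact ⟨ofPoint W (bd B₀), fun h' => absurd h' h⟩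
  choose u hu using this
  have hune : ∀ B ∈ crossed L, ∀ B' ∈ crossed L, B ≠ B' → u B ≠ u B' := by
    intro B hB B' hB' hne h
    have h1 := (hu B hB).2
    have h2 := (hu B' hB').2
    rw [← h] at h2
    exact hne (wall_unique hB'.1 hB.1 h2.1 h2.2 h1.1 h1.2)
  have hsep : ∀ B₁ ∈ crossed L, ∀ B₂ ∈ crossed L, ∀ B₃ ∈ crossed L, B₁ ≠ B₂ → B₂ ≠ B₃ →
      btw (u B₁) (u B₂) (u B₃) → ¬ (bd B₁ ∈ B₂ ↔ bd B₃ ∈ B₂) := by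
    intro B₁ h₁ B₂ h₂ B₃ h₃ h12 h23 h
    exact separates_of_btw h h₁.1 h₂.1 h₃.1 h12.symm h23 (hu _ h₁).2 (hu _ h₂).2 (hu _ h₃).2
  let R : Set T := bd '' crossed L
  have hR : IsLinear R := by
    rintro _ ⟨B₁, h₁, rfl⟩ _ ⟨B₂, h₂, rfl⟩ _ ⟨B₃, h₃, rfl⟩ h12 h23 h13
    have e12 : B₁ ≠ B₂ := fun h => h12 (h ▸ rfl)
    have e23 : B₂ ≠ B₃ := fun h => h23 (h ▸ rfl)
    have e13 : B₁ ≠ B₃ := fun h => h13 (h ▸ rfl)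
    have key : ∀ B₁ ∈ crossed L, ∀ B₂ ∈ crossed L, ∀ B₃ ∈ crossed L, bd B₁ ≠ bd B₂ →
        bd B₂ ≠ bd B₃ → btw (u B₁) (u B₂) (u B₃) → btw (bd B₁) (bd B₂) (bd B₃) := by
      intro B₁ h₁ B₂ h₂ B₃ h₃ h12 h23 h
      rcases bd_mem_seg_of_separates W h₂.1 (hsep B₁ h₁ B₂ h₂ B₃ h₃ (fun h => h12 (h ▸ rfl))
        (fun h => h23 (h ▸ rfl)) h) with h' | h' | h'
      · exact absurd h'.symm h12
      · exact absurd h' h23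
      · exact h'
    rcases hL _ (hu _ h₁).1 _ (hu _ h₂).1 _ (hu _ h₃).1 (hune _ h₁ _ h₂ e12)
      (hune _ h₂ _ h₃ e23) (hune _ h₁ _ h₃ e13) with h | h | h
    · exact Or.inl (key _ h₁ _ h₂ _ h₃ h12 h23 h)
    · exact Or.inr (Or.inl (key _ h₂ _ h₃ _ h₁ h23 h13.symm h))
    · exact Or.inr (Or.inr (key _ h₃ _ h₁ _ h₂ h13.symm h12 h))
  let X : Set (Set T) := {B ∈ crossed L | ∀ x ∈ R, ∀ y ∈ R, x ∈ B ↔ y ∈ B}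
  -- Of three walls, the one whose `u` is in the middle separates the boundary points of the other
  -- two, so at most two walls fail to separate `R`.
  have hX : X.Finite := by
    by_contra hinf
    obtain ⟨F, hFX, hF⟩ := Set.Infinite.exists_subset_card_eq hinf 3
    obtain ⟨B₁, B₂, B₃, e12, e13, e23, rfl⟩ := Finset.card_eq_three.1 hF
    have h₁ : B₁ ∈ X := hFX (by simp)
    have h₂ : B₂ ∈ X := hFX (by simp)
    have h₃ : B₃ ∈ X := hFX (by simp)
    have key : ∀ B₁ ∈ X, ∀ B₂ ∈ X, ∀ B₃ ∈ X, B₁ ≠ B₂ → B₂ ≠ B₃ → ¬ btw (u B₁) (u B₂) (u B₃) := by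
      intro B₁ h₁ B₂ h₂ B₃ h₃ e12 e23 h
      exact hsep _ h₁.1 _ h₂.1 _ h₃.1 e12 e23 h (h₂.2 _ ⟨B₁, h₁.1, rfl⟩ _ ⟨B₃, h₃.1, rfl⟩)
    rcases hL _ (hu _ h₁.1).1 _ (hu _ h₂.1).1 _ (hu _ h₃.1).1 (hune _ h₁.1 _ h₂.1 e12)
      (hune _ h₂.1 _ h₃.1 e23) (hune _ h₁.1 _ h₃.1 e13) with h | h | h
    · exact key _ h₁ _ h₂ _ h₃ e12 e23 h
    · exact key _ h₂ _ h₃ _ h₁ e23 e13.symm h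
    · exact key _ h₃ _ h₁ _ h₂ e13.symm e12 h
  refine ((W.countable R hR).union hX.countable).mono fun B hB => ?_
  by_cases h : B ∈ X
  · exact Or.inr h
  · left
    have h' : ¬ ∀ x ∈ R, ∀ y ∈ R, x ∈ B ↔ y ∈ B := fun h' => h ⟨hB, h'⟩
    push Not at h'
    obtain ⟨x, hx, y, hy, ⟨h1, h2⟩ | ⟨h1, h2⟩⟩ := h'
    · exact ⟨hB.1, x, hx, y, hy, h1, h2⟩
    · exact ⟨hB.1, y, hy, x, hx, h2, h1⟩

section wdist

variable {w : Set T → ℝ}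

theorem wdist_add (hw : Summable w) (hw0 : ∀ h, 0 ≤ w h) {s t u : Dual W} (h : u ∈ seg s t) :
    wdist w s t = wdist w s u + wdist w u t := by
  rw [wdist, wdist, wdist, ← Summable.tsum_add
    (summable_wdist hw hw0 s.isConsistent u.isConsistent)
    (summable_wdist hw hw0 u.isConsistent t.isConsistent)]
  refine tsum_congr fun k => ?_
  rw [← mul_add]
  congr 1
  have := mem_seg_iff.1 h k
  rw [Set.mem_uIcc] at this
  rcases this with h1 | h1
  · rw [abs_of_nonpos (by linarith), abs_of_nonpos (by linarith), abs_of_nonpos (by linarith)]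
    ring
  · rw [abs_of_nonneg (by linarith), abs_of_nonneg (by linarith), abs_of_nonneg (by linarith)]
    ring

theorem wdist_pos (hw : Summable w) (hw0 : ∀ h, 0 ≤ w h) (hwL : ∀ B ∈ crossed L, 0 < w B)
    {s t : Dual W} (hs : s ∈ L) (ht : t ∈ L) (hst : s ≠ t) : 0 < wdist w s t := by
  obtain ⟨B, hB, h⟩ := exists_wall_lt_or_gt hst
  refine (summable_wdist hw hw0 s.isConsistent t.isConsistent).tsum_pos
    (fun h => mul_nonneg (hw0 h) (abs_nonneg _)) B ?_
  exact mul_pos (hwL B ⟨hB, s, hs, t, ht, h⟩) (abs_pos.2 (sub_ne_zero.2 h))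

/-- The segment `[s, t]` is compact in the product topology and `wdist` is continuous on it. The
farthest point at distance at most `c` and the nearest at distance at least `c` must coincide, for a
point between them would contradict one of the two choices. -/
theorem exists_wdist_eq (hw : Summable w) (hw0 : ∀ h, 0 ≤ w h)
    (hwL : ∀ B ∈ crossed L, 0 < w B) (hconv : IsConvex L) {s t : Dual W} (hs : s ∈ L)
    (ht : t ∈ L) {c : ℝ} (hc0 : 0 ≤ c) (hc : c ≤ wdist w s t) :
    ∃ z ∈ L, z ∈ seg s t ∧ wdist w s z = c := by
  let K : Set (Set T → ℝ) := (Set.univ.pi fun h => Set.uIcc (s h) (t h)) ∩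
    {u | IsConsistent 𝓑 u}
  have hK : IsCompact K :=
    (isCompact_univ_pi fun h => isCompact_uIcc).inter_right (isClosed_isConsistent 𝓑)
  have hcont : ContinuousOn (fun u : Set T → ℝ => wdist w s u) K := by
    refine continuousOn_tsum (fun h => ?_) hw (fun h u hu => ?_)
    · exact (continuous_const.mul (continuous_const.sub (continuous_apply h)).abs).continuousOn
    · rw [Real.norm_of_nonneg (mul_nonneg (hw0 h) (abs_nonneg _))]
      refine mul_le_of_le_one_right (hw0 h) (abs_le.2 ⟨?_, ?_⟩)
      · linarith [s.isConsistent.nonneg h, hu.2.le_one h]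
      · linarith [hu.2.nonneg h, s.isConsistent.le_one h]
  have hdual : ∀ u ∈ K, ∃ v : Dual W, v ∈ seg s t ∧ v.toFun = u := by
    intro u hu
    have h1 : ∀ h, u h ∈ Set.uIcc (s h) (t h) := fun h => hu.1 h (Set.mem_univ h)
    exact ⟨⟨u, W.isDualPoint_of_mem_uIcc s.isDualPoint t.isDualPoint hu.2 h1⟩,
      mem_seg_iff.2 h1, rfl⟩
  have hmemK : ∀ v : Dual W, v ∈ seg s t → v.toFun ∈ K := fun v hv =>
    ⟨fun h _ => mem_seg_iff.1 hv h, v.isConsistent⟩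
  have hK1 : IsCompact (K ∩ (fun u : Set T → ℝ => wdist w s u) ⁻¹' Set.Iic c) :=
    hK.of_isClosed_subset (hcont.preimage_isClosed_of_isClosed hK.isClosed isClosed_Iic)
      Set.inter_subset_left
  have hK2 : IsCompact (K ∩ (fun u : Set T → ℝ => wdist w s u) ⁻¹' Set.Ici c) :=
    hK.of_isClosed_subset (hcont.preimage_isClosed_of_isClosed hK.isClosed isClosed_Ici)
      Set.inter_subset_left
  obtain ⟨u, ⟨huK, huc⟩, humax⟩ := hK1.exists_isMaxOn
    ⟨s, hmemK s (left_mem_seg _ _), by simpa [wdist_self] using hc0⟩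
    (hcont.mono Set.inter_subset_left)
  obtain ⟨v, ⟨hvK, hvc⟩, hvmin⟩ := hK2.exists_isMinOn
    ⟨t, hmemK t (right_mem_seg _ _), hc⟩ (hcont.mono Set.inter_subset_left)
  obtain ⟨u, hu, rfl⟩ := hdual u huK
  obtain ⟨v, hv, rfl⟩ := hdual v hvK
  have hsegL : ∀ {z}, z ∈ seg s t → z ∈ L := fun hz => hconv s hs t ht hz
  have huc' : wdist w s u ≤ c := huc
  have hvc' : c ≤ wdist w s v := hvc
  rcases huc'.eq_or_lt with hu' | hu'
  · exact ⟨u, hsegL hu, hu, hu'⟩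
  exfalso
  have huv : u ≠ v := by
    rintro rfl
    linarith
  have husv : u ∈ seg s v := by
    by_cases h1 : u ∈ seg s v
    · exact h1
    have h2 : v ∈ seg s u := by
      rcases hu with rfl | rfl | hu
      · exact absurd (left_mem_seg _ _) h1
      · exact hv
      rcases hv with rfl | rfl | hv
      · exact left_mem_seg _ _
      · exact absurd hu.mem_seg h1
      rcases hu.or huv with h | h
      · exact absurd h.mem_seg h1
      · exact (h.trans_right hv.symm).symm.mem_seg
    have h3 := wdist_add hw hw0 h2
    have h4 := wdist_pos hw hw0 hwL (hsegL hv) (hsegL hu) huv.symm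
    linarith
  obtain ⟨m, hm⟩ := exists_btw huv
  have hm1 : m ∈ seg s v := seg_subset_right husv hm.mem_seg
  have hm2 : u ∈ seg s m := by
    rcases husv with rfl | h | h
    · exact left_mem_seg _ _
    · exact absurd h huv
    · exact (hm.symm.trans_right h.symm).symm.mem_seg
  have hms : m ∈ seg s t := seg_subset_left hv hm1
  have h1 := wdist_add hw hw0 hm1
  have h2 := wdist_add hw hw0 hm2
  have h3 := wdist_pos hw hw0 hwL (hsegL hu) (hsegL hms) hm.ne_left.symm
  have h4 := wdist_pos hw hw0 hwL (hsegL hms) (hsegL hv) hm.ne_right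
  rcases le_total (wdist w s m) c with h5 | h5
  · have h6 : wdist w s m ≤ wdist w s u := humax ⟨hmemK m hms, h5⟩
    linarith
  · have h6 : wdist w s v ≤ wdist w s m := hvmin ⟨hmemK m hms, h5⟩
    linarith

end wdist

theorem isRTree (W : WallSystem G 𝓑 bd) : IsRTree (Dual W) := by
  intro L hL
  have hconv := hL.isConvex_of_isLinear
  have hcount := countable_crossed hL.1 hconv
  -- Countability of the crossed walls allows weights that are positive on all of them and summable.
  obtain ⟨w, hw, hw0, hwL⟩ : ∃ w : Set T → ℝ, Summable w ∧ (∀ h, 0 ≤ w h) ∧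
      ∀ B ∈ crossed L, 0 < w B := by
    obtain ⟨ε, hε, c, hc, -⟩ := hcount.exists_pos_hasSum_le one_pos
    refine ⟨(crossed L).indicator ε, summable_subtype_iff_indicator.1 hc.summable,
      fun h => Set.indicator_nonneg (fun h _ => (hε h).le) h, fun B hB => ?_⟩
    rw [Set.indicator_of_mem hB]
    exact hε B
  exact isRealInterval_of_dist hL.1 (fun s t => wdist w s t) (fun s => wdist_self _)
    (fun s t => wdist_comm _ _) (fun s hs t ht hst => wdist_pos hw hw0 hwL hs ht hst)
    (fun s _ u _ t _ h => wdist_add hw hw0 h.mem_seg)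
    (fun s hs t ht c hc0 hc => exists_wdist_eq hw hw0 hwL hconv hs ht hc0 hc)

end Dual

/-! ### The action on the dual tree -/

theorem IsDualPoint.smul {G T : Type*} [Group G] [MulAction G T] {𝓑 : Set (Set T)}
    (h𝓑 : ∀ (g : G), ∀ B ∈ 𝓑, g • B ∈ 𝓑) {s : Set T → ℝ} (hs : IsDualPoint 𝓑 s) (g : G) :
    IsDualPoint 𝓑 fun h => s (g⁻¹ • h) := by
  have hmem : ∀ (g : G), ∀ h ∈ halfspaces 𝓑, g • h ∈ halfspaces 𝓑 := by
    rintro g h (hh | hh)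
    · exact Or.inl (h𝓑 g h hh)
    · right
      rw [← Set.smul_set_compl]
      exact h𝓑 g _ hh
  have hmem' : ∀ (g : G) h, g • h ∈ halfspaces 𝓑 → h ∈ halfspaces 𝓑 := by
    intro g h hh
    simpa using hmem g⁻¹ _ hh
  refine ⟨⟨fun h hh => ?_, fun h => hs.1.nonneg _, fun h hh => ?_, fun h hh k hk hsub hne => ?_⟩,
    ?_⟩
  · exact hs.1.eq_zero_of_notMem _ fun h' => hh (hmem' _ _ h')
  · rw [Set.smul_set_compl]
    exact hs.1.compl _ (hmem _ _ hh)
  · exact hs.1.eq_or_eq _ (hmem _ _ hh) _ (hmem _ _ hk) (Set.smul_set_mono hsub)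
      (fun h' => hne (smul_left_cancel _ h'))
  · rcases hs.2 with ⟨h, hh, h1⟩ | ⟨x, rfl⟩
    · exact Or.inl ⟨g • h, hmem _ _ hh, by simpa using h1⟩
    · refine Or.inr ⟨g • x, funext fun h => ?_⟩
      by_cases hh : h ∈ halfspaces 𝓑
      · by_cases hx : g • x ∈ h
        · rw [pointFun_of_mem hh hx, pointFun_of_mem (hmem _ _ hh)
            (Set.mem_smul_set_iff_inv_smul_mem.2 (by simpa using hx))]
        · rw [pointFun_of_notMem hx, pointFun_of_notMem]
          rw [Set.mem_smul_set_iff_inv_smul_mem]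
          simpa using hx
      · rw [(isConsistent_pointFun _).eq_zero_of_notMem h hh,
          (isConsistent_pointFun _).eq_zero_of_notMem _ fun h' => hh (hmem' _ _ h')]

namespace Dual

variable {G T : Type*} [Group G] [Pretree T] [MulAction G T] {𝓑 : Set (Set T)} {bd : Set T → T}
  {W : WallSystem G 𝓑 bd} {B : Set T}

instance : MulAction G (Dual W) where
  smul g s := ⟨fun h => s (g⁻¹ • h), s.isDualPoint.smul W.smul_mem g⟩
  one_smul s := ext fun h => by
    change s ((1 : G)⁻¹ • h) = s h
    rw [inv_one, one_smul]
  mul_smul g k s := ext fun h => by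
    change s ((g * k)⁻¹ • h) = s (k⁻¹ • g⁻¹ • h)
    rw [mul_inv_rev, mul_smul]

theorem smul_apply (g : G) (s : Dual W) (h : Set T) : (g • s) h = s (g⁻¹ • h) := rfl

theorem smul_apply_smul (g : G) (s : Dual W) (h : Set T) : (g • s) (g • h) = s h := by
  rw [smul_apply, inv_smul_smul]

theorem smul_ofPoint (g : G) (x : T) : g • ofPoint W x = ofPoint W (g • x) := by
  refine ext_of_wall fun B hB => ?_
  have hB' := mem_halfspaces (W.smul_mem g⁻¹ B hB)
  rw [smul_apply]
  change pointFun 𝓑 x _ = pointFun 𝓑 (g • x) B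
  by_cases hx : g • x ∈ B
  · rw [pointFun_of_mem (mem_halfspaces hB) hx,
      pointFun_of_mem hB' (Set.mem_smul_set_iff_inv_smul_mem.2 (by simpa using hx))]
  · rw [pointFun_of_notMem hx, pointFun_of_notMem]
    rw [Set.mem_smul_set_iff_inv_smul_mem]
    simpa using hx

theorem btw_smul (g : G) (s u t : Dual W) (h : btw s u t) : btw (g • s) (g • u) (g • t) :=
  ⟨fun h' => h.1 (smul_left_cancel g h'), fun h' => h.2.1 (smul_left_cancel g h'),
    fun k => h.2.2 (g⁻¹ • k)⟩

instance : TopologicalSpace (Dual W) := branchTopology (Dual W)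

instance : ContinuousConstSMul G (Dual W) := by
  refine ⟨fun g => continuous_generateFrom_iff.2 ?_⟩
  rintro _ ⟨p, q, hq, rfl⟩
  have : (fun s : Dual W => g • s) ⁻¹' branch p q = branch (g⁻¹ • p) (g⁻¹ • q) := by
    ext s
    rw [Set.mem_preimage, ← smul_mem_branch_iff btw_smul g (y := s), smul_inv_smul, smul_inv_smul]
  rw [this]
  exact TopologicalSpace.isOpen_generateFrom_of_mem
    ⟨_, _, fun h => hq (smul_left_cancel _ h), rfl⟩

instance : Nontrivial (Dual W) := by
  obtain ⟨B, hB⟩ := W.nonempty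
  obtain ⟨q, hq⟩ := W.exists_isAdjacent_bd hB
  refine ⟨ofPoint W q, ofPoint W (bd B), fun h => ?_⟩
  have h1 : pointFun 𝓑 q B = pointFun 𝓑 (bd B) B := congrArg (fun s : Dual W => s B) h
  rw [pointFun_of_mem (mem_halfspaces hB) hq.mem, pointFun_of_notMem hq.notMem] at h1
  exact one_ne_zero h1

theorem exists_frac_wall {s : Dual W} {h : Set T} (hh : h ∈ halfspaces 𝓑) (h0 : 0 < s h)
    (h1 : s h < 1) : ∃ B ∈ 𝓑, 0 < s B ∧ s B < 1 := by
  obtain hB | hB := id hh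
  · exact ⟨h, hB, h0, h1⟩
  · refine ⟨hᶜ, hB, ?_⟩
    rw [s.isConsistent.compl h hh]
    constructor <;> linarith

theorem frac_or_eq_ofPoint (s : Dual W) :
    (∃ B ∈ 𝓑, 0 < s B ∧ s B < 1) ∨ ∃ x, s = ofPoint W x := by
  rcases s.isDualPoint.2 with ⟨h, hh, h0, h1⟩ | ⟨x, hx⟩
  · exact Or.inl (exists_frac_wall hh h0 h1)
  · exact Or.inr ⟨x, ext fun k => by rw [hx]; rfl⟩

theorem smul_eq_of_frac {s : Dual W} {g : G} (hB : B ∈ 𝓑) (h0 : 0 < s B) (h1 : s B < 1)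
    (hg : g • s = s) : g • B = B := by
  have h2 : s (g • B) = s B := by
    conv_lhs => rw [← hg]
    exact smul_apply_smul g s B
  exact wall_unique hB (W.smul_mem g B hB) h0 h1 (h2 ▸ h0) (h2 ▸ h1)

theorem exists_frac_mem_seg_of_ne {a b : Dual W} (hab : a ≠ b) :
    ∃ u ∈ seg a b, ∃ B ∈ 𝓑, 0 < u B ∧ u B < 1 := by
  obtain ⟨B, hB, h⟩ := exists_wall_lt_or_gt hab
  obtain ⟨u, hu, h0, h1, -⟩ := exists_frac_mem_seg hB h
  exact ⟨u, hu, B, hB, h0, h1⟩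

/-- At the value `1` the function `wallFun` is the end vertex of the edge, so a segment running over
the edge to its end passes through that vertex. -/
theorem ofPoint_mem_seg {s t : Dual W} {h : Set T} {p p' : T} (ha : IsAdjacent 𝓑 h p p')
    (hs : s h < 1) (ht : t h = 1) : ofPoint W p ∈ seg s t := by
  refine mem_seg_iff.2 fun k => ?_
  have := W.wallFun_mem_uIcc s.isConsistent t.isConsistent ha (ht ▸ hs) hs.le ht.ge k
  rwa [ha.wallFun_one] at this

theorem mem_seg_of_isAdjacent {s : Dual W} {h : Set T} {p p' : T} (ha : IsAdjacent 𝓑 h p p')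
    (h0 : 0 < s h) (h1 : s h < 1) : s ∈ seg (ofPoint W p') (ofPoint W p) := by
  refine mem_seg_iff.2 fun k => ?_
  have e1 : ofPoint W p h = 1 := pointFun_of_mem ha.mem_halfspaces ha.mem
  have e0 : ofPoint W p' h = 0 := pointFun_of_notMem ha.notMem
  rw [W.eq_wallFun s.isConsistent ha h0 h1]
  exact W.wallFun_mem_uIcc (ofPoint W p').isConsistent (ofPoint W p).isConsistent ha
    (by rw [e0, e1]; exact one_pos) (by rw [e0]; exact h0.le) (by rw [e1]; exact h1.le) k

theorem ofPoint_mem_seg_ofPoint {x y z : T} (hz : z ∈ seg x y) :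
    ofPoint W z ∈ seg (ofPoint W x) (ofPoint W y) := by
  refine mem_seg_iff.2 fun k => ?_
  change pointFun 𝓑 z k ∈ Set.uIcc (pointFun 𝓑 x k) (pointFun 𝓑 y k)
  by_cases hk : k ∈ halfspaces 𝓑
  swap
  · rw [(isConsistent_pointFun z).eq_zero_of_notMem k hk,
      (isConsistent_pointFun x).eq_zero_of_notMem k hk]
    exact Set.left_mem_uIcc
  by_cases hzk : z ∈ k
  · by_cases hx : x ∈ k
    · rw [pointFun_of_mem hk hzk, pointFun_of_mem hk hx]
      exact Set.left_mem_uIcc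
    by_cases hy : y ∈ k
    · rw [pointFun_of_mem hk hzk, pointFun_of_mem hk hy]
      exact Set.right_mem_uIcc
    exact absurd hzk (W.halfspaces_isConvex (compl_mem_halfspaces hk) _ hx _ hy hz)
  · by_cases hx : x ∈ k
    · by_cases hy : y ∈ k
      · exact absurd (W.halfspaces_isConvex hk _ hx _ hy hz) hzk
      · rw [pointFun_of_notMem hzk, pointFun_of_notMem hy]
        exact Set.right_mem_uIcc
    · rw [pointFun_of_notMem hzk, pointFun_of_notMem hx]
      exact Set.left_mem_uIcc

/-- An invariant subtree that contains one vertex pulls back to an invariant subtree of `T`, hence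
contains all vertices, and then all edges between them. -/
theorem actsMinimally (W : WallSystem G 𝓑 bd) (hmin : ActsMinimally G T) :
    ActsMinimally G (Dual W) := by
  rintro A ⟨s, hs⟩ hA hinv
  obtain ⟨x, hx⟩ : ∃ x, ofPoint W x ∈ A := by
    rcases frac_or_eq_ofPoint s with ⟨B, hB, h0, h1⟩ | ⟨x, rfl⟩
    swap
    · exact ⟨x, hs⟩
    obtain ⟨q, hq⟩ := W.exists_isAdjacent_bd hB
    -- Otherwise `B` would be a proper invariant subtree of `T`. Since `g • s` lies off the edge of
    -- `s`, the segment joining them passes an end of that edge.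
    obtain ⟨g, hg⟩ : ∃ g : G, g • B ≠ B := by
      by_contra! hfix
      have h2 := hmin B ⟨q, hq.mem⟩ (W.isConvex B hB) fun g x hx => by
        rw [← hfix g]
        exact Set.smul_mem_smul_set hx
      exact W.bd_notMem B hB (h2 ▸ Set.mem_univ _)
    have h0' : 0 < (g • s) (g • B) := by rwa [smul_apply_smul]
    have h1' : (g • s) (g • B) < 1 := by rwa [smul_apply_smul]
    by_cases hm : bd (g • B) ∈ B
    · have h2 := apply_eq_one_of_bd_mem (W.smul_mem g B hB) hB hg.symm h0' h1' hm
      exact ⟨q, hA s hs _ (hinv g s hs) (ofPoint_mem_seg hq h1 h2)⟩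
    · have h2 := apply_eq_zero_of_bd_notMem (W.smul_mem g B hB) hB hg.symm h0' h1' hm
      refine ⟨bd B, hA s hs _ (hinv g s hs) (ofPoint_mem_seg hq.symm ?_ ?_)⟩
      · rw [s.isConsistent.compl B hq.mem_halfspaces]
        linarith
      · rw [(g • s).isConsistent.compl B hq.mem_halfspaces, h2, sub_zero]
  have hall : ∀ y, ofPoint W y ∈ A := by
    have := hmin {y | ofPoint W y ∈ A} ⟨x, hx⟩
      (fun y hy z hz w hw => hA _ hy _ hz (ofPoint_mem_seg_ofPoint hw))
      (fun g y hy => by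
        change ofPoint W (g • y) ∈ A
        rw [← smul_ofPoint]
        exact hinv g _ hy)
    exact fun y => Set.eq_univ_iff_forall.1 this y
  refine Set.eq_univ_of_forall fun t => ?_
  rcases frac_or_eq_ofPoint t with ⟨B, hB, h0, h1⟩ | ⟨x, rfl⟩
  · obtain ⟨q, hq⟩ := W.exists_isAdjacent_bd hB
    exact hA _ (hall _) _ (hall _) (mem_seg_of_isAdjacent hq h0 h1)
  · exact hall x

/-- The bound `y` of a drifting orbit is thereby transferred to `T`; for `y` inside an edge, the
boundary point of its wall serves. -/
theorem exists_point_of_apply_eq (y : Dual W) :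
    ∃ x : T, ∀ B ∈ 𝓑, (y B = 1 → x ∈ B) ∧ (y B = 0 → x ∉ B) := by
  rcases frac_or_eq_ofPoint y with ⟨B', hB', h0, h1⟩ | ⟨x, rfl⟩
  · refine ⟨bd B', fun B hB => ?_⟩
    by_cases hne : B = B'
    · subst hne
      exact ⟨fun h => absurd h h1.ne, fun h => absurd h h0.ne'⟩
    · refine ⟨fun h => ?_, fun h h' => ?_⟩
      · by_contra h'
        rw [apply_eq_zero_of_bd_notMem hB' hB hne h0 h1 h'] at h
        exact zero_ne_one h
      · rw [apply_eq_one_of_bd_mem hB' hB hne h0 h1 h'] at h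
        exact one_ne_zero h
  · refine ⟨x, fun B hB => ⟨fun h => ?_, fun h h' => ?_⟩⟩
    · by_contra h'
      have : pointFun 𝓑 x B = 1 := h
      rw [pointFun_of_notMem h'] at this
      exact zero_ne_one this
    · have : pointFun 𝓑 x B = 0 := h
      rw [pointFun_of_mem (mem_halfspaces hB) h'] at this
      exact one_ne_zero this

theorem not_actsNestingly (W : WallSystem G 𝓑 bd) : ¬ ActsNestingly G (Dual W) := by
  rintro ⟨g, a, b, -, hg⟩
  obtain ⟨hsub, c', hc', hcg'⟩ := Set.ssubset_iff_exists.1 hg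
  -- a fractional point that is lost
  obtain ⟨c, hc, hcg, B, hB, h0, h1⟩ : ∃ c ∈ seg a b, c ∉ (fun z => g • z) '' seg a b ∧
      ∃ B ∈ 𝓑, 0 < c B ∧ c B < 1 := by
    rw [image_smul_seg btw_smul] at hcg' hsub ⊢
    have hex : ∃ h, c' h ∉ Set.uIcc ((g • a) h) ((g • b) h) := by
      rw [mem_seg_iff] at hcg'
      exact not_forall.1 hcg'
    obtain ⟨h, hh, hlt⟩ : ∃ h ∈ halfspaces 𝓑, (g • a) h < c' h ∧ (g • b) h < c' h := by
      obtain ⟨h, hh, h2, h3⟩ := exists_lt_of_notMem hex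
      refine ⟨hᶜ, compl_mem_halfspaces hh, ?_⟩
      rw [(g • a).isConsistent.compl h hh, (g • b).isConsistent.compl h hh,
        c'.isConsistent.compl h hh]
      constructor <;> linarith
    -- A value strictly between both ends of the image and `c' h` is fractional and not attained on
    -- the image; half way is taken.
    obtain ⟨c, hc, hch⟩ := exists_mem_seg hh hlt.1
      (c := (max ((g • a) h) ((g • b) h) + c' h) / 2)
      (by linarith [le_max_left ((g • a) h) ((g • b) h), max_lt hlt.1 hlt.2])
      (by linarith [max_lt hlt.1 hlt.2])
    have h4 : max ((g • a) h) ((g • b) h) < c h := by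
      rw [hch]
      linarith [max_lt hlt.1 hlt.2]
    have h5 : c h < c' h := by
      rw [hch]
      linarith [max_lt hlt.1 hlt.2]
    refine ⟨c, isConvex_seg _ _ _ (hsub (left_mem_seg _ _)) _ hc' hc, fun h6 => ?_,
      exists_frac_wall hh ?_ (h5.trans_le (c'.isConsistent.le_one h))⟩
    · exact h4.not_ge (mem_seg_iff.1 h6 h).2
    · exact ((g • a).isConsistent.nonneg h).trans_lt ((le_max_left _ _).trans_lt h4)
  obtain ⟨k, y, -, hk, hy⟩ := (isRTree W).exists_monotone_orbit btw_smul hsub hc hcg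
  have hb : ∀ n : ℕ, btw (k ^ n • c) (k ^ (n + 1) • c) (k ^ (n + 2) • c) := by
    intro n
    have := btw_smul (k ^ n) _ _ _ hk
    rwa [← mul_smul, ← mul_smul, ← mul_smul, ← pow_succ, ← pow_succ] at this
  have hbt : ∀ {i j l : ℕ}, i < j → j < l → btw (k ^ i • c) (k ^ j • c) (k ^ l • c) :=
    fun hij hjl => btw_of_lt_of_lt (c := fun n => k ^ n • c) hb hij hjl
  have hBn : ∀ n : ℕ, k ^ n • B ∈ 𝓑 := fun n => W.smul_mem _ _ hB
  have hval : ∀ n : ℕ, (k ^ n • c) (k ^ n • B) = c B := fun n => smul_apply_smul _ _ _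
  have hfrac : ∀ n : ℕ, 0 < (k ^ n • c) (k ^ n • B) ∧ (k ^ n • c) (k ^ n • B) < 1 := by
    intro n
    rw [hval]
    exact ⟨h0, h1⟩
  -- The points `k ^ n • c` all have the same coordinate on their own walls, so equal walls would
  -- give equal points.
  have hne : ∀ i j : ℕ, i < j → k ^ i • B ≠ k ^ j • B := by
    intro i j hij h
    refine (hbt hij j.lt_succ_self).ne_left
      (eq_of_apply_eq (hBn j) (hfrac j).1 (hfrac j).2 ?_)
    rw [hval j, ← h, hval i]
  have hbdn : ∀ n : ℕ, bd (k ^ n • B) = k ^ n • bd B := fun n => W.bd_smul _ _ hB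
  have hsep : ¬ (bd B ∈ k • B ↔ k • k • bd B ∈ k • B) := by
    have := separates_of_btw (hbt Nat.zero_lt_one Nat.one_lt_two) (hBn 0) (hBn 1) (hBn 2)
      (hne 0 1 one_pos).symm (hne 1 2 Nat.one_lt_two) (hfrac 0) (hfrac 1) (hfrac 2)
    rwa [hbdn, hbdn, pow_zero, one_smul, pow_one, pow_two, mul_smul] at this
  have hmem1 : k • bd B ∈ seg (bd B) (k • k • bd B) := by
    rw [← W.bd_smul k B hB]
    exact bd_mem_seg_of_separates W (W.smul_mem k B hB) (by rwa [W.bd_smul k B hB])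
  have hbd : btw (bd B) (k • bd B) (k • k • bd B) := by
    have h2 : k • bd B ≠ bd B := fun h => hsep (by rw [h, h])
    rcases hmem1 with h | h | h
    · exact absurd h h2
    · exact absurd (smul_left_cancel k h).symm h2
    · exact h
  obtain ⟨x, hx⟩ := exists_point_of_apply_eq y
  refine hsep (W.no_drift k x B hB hbd fun n => ?_)
  rcases Nat.eq_zero_or_pos n with rfl | hn
  · simpa using left_mem_seg _ _
  have hcy : ∀ n : ℕ, k ^ n • c ∈ seg c y := by
    intro n
    induction n with
    | zero => simpa using left_mem_seg c y
    | succ n ih => exact seg_subset_right ih (hy n)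
  rw [← hbdn]
  refine bd_mem_seg_of_separates W (hBn n) ?_
  have hBn0 : k ^ n • B ≠ B := by
    have := hne 0 n hn
    rw [pow_zero, one_smul] at this
    exact this.symm
  have hbn : btw c (k ^ n • c) (k ^ (n + 1) • c) := by
    simpa using hbt hn n.lt_succ_self
  have m1 := hbn.2.2 (k ^ n • B)
  have m2 := mem_seg_iff.1 (hy n) (k ^ n • B)
  have hf := hfrac n
  have hyn := y.isConsistent.nonneg (k ^ n • B)
  have hyl := y.isConsistent.le_one (k ^ n • B)
  rw [Set.mem_uIcc] at m1 m2
  have hnext : (k ^ (n + 1) • c) (k ^ n • B) = 0 ∨ (k ^ (n + 1) • c) (k ^ n • B) = 1 := by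
    have hne' := hne n (n + 1) n.lt_succ_self
    by_cases hm : bd (k ^ (n + 1) • B) ∈ k ^ n • B
    · exact Or.inr (apply_eq_one_of_bd_mem (hBn _) (hBn _) hne' (hfrac _).1 (hfrac _).2 hm)
    · exact Or.inl (apply_eq_zero_of_bd_notMem (hBn _) (hBn _) hne' (hfrac _).1 (hfrac _).2 hm)
  -- On the wall `k ^ n • B` the orbit passes from an extreme value at `c` through a fractional one
  -- to the opposite extreme, and `y` lies beyond. So the wall separates `bd B` from `x`.
  by_cases hm : bd B ∈ k ^ n • B
  · have e0 := apply_eq_one_of_bd_mem hB (hBn n) hBn0 h0 h1 hm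
    have e1 : y (k ^ n • B) = 0 := by
      rw [e0] at m1
      rcases hnext with h | h <;> rw [h] at m1 m2 <;> rcases m1 with m1 | m1 <;>
        rcases m2 with m2 | m2 <;> linarith
    exact fun h => (hx _ (hBn n)).2 e1 (h.1 hm)
  · have e0 := apply_eq_zero_of_bd_notMem hB (hBn n) hBn0 h0 h1 hm
    have e1 : y (k ^ n • B) = 1 := by
      rw [e0] at m1
      rcases hnext with h | h <;> rw [h] at m1 m2 <;> rcases m1 with m1 | m1 <;>
        rcases m2 with m2 | m2 <;> linarith
    exact fun h => hm (h.2 ((hx _ (hBn n)).1 e1))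

end Dual

/-! ### The main theorem -/

theorem mainTheorem2 (G : Type v) [Group G] [Group.FG G]
    (T : Type u) [Pretree T] [TopologicalSpace T] [MulAction G T] [ContinuousConstSMul G T]
    (hT : IsRTree T) (hTtop : IsTreeTopology T)
    (hmin : ActsMinimally G T) (hnest : ActsNestingly G T) (hover : NonOverlapping G T) :
    ∃ (S : Type u) (_ : Pretree S) (_ : TopologicalSpace S) (_ : MulAction G S),
      IsRTree S ∧ IsTreeTopology S ∧ ContinuousConstSMul G S ∧ Nontrivial S ∧
      ActsMinimally G S ∧ ¬ ActsNestingly G S ∧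
      ∀ a b : S, a ≠ b → ∃ (Q : Set T) (e : T), IsCrossComponent G Q ∧ IsEndpoint Q e ∧
        ∀ g : G, (∀ x ∈ Pretree.seg a b, g • x = x) →
          (fun x : T => g • x) '' Q = Q ∧ g • e = e := by
  obtain ⟨bd, W, hbd⟩ := exists_wallSystem (G := G) hTtop hT hover hnest
  refine ⟨Dual W, inferInstance, inferInstance, inferInstance, Dual.isRTree W,
    (Dual.isRTree W).isTreeTopology_branchTopology, inferInstance, inferInstance,
    Dual.actsMinimally W hmin, Dual.not_actsNestingly W, fun a b hab => ?_⟩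
  -- A point `u` of the arc interior to an edge: fixing `u` preserves its wall `B`, which determines
  -- `Q` and the endpoint `bd B`.
  obtain ⟨u, hu, B, hB, h0, h1⟩ := Dual.exists_frac_mem_seg_of_ne hab
  obtain ⟨Q, hQ⟩ := hbd B hB
  refine ⟨Q, bd B, hQ.isCrossComponent, hQ.isEndpoint, fun g hg => ?_⟩
  have h2 := hQ.smul hTtop.btw_smul g
  rw [Dual.smul_eq_of_frac hB h0 h1 (hg u hu)] at h2
  obtain ⟨h3, h4⟩ := hQ.unique hTtop hT h2
  exact ⟨h4.symm, h3.symm⟩
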